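/- Let $k\in\mathbb{C}\setminus\{0\}$ and $n,e\in\mathbb{C}$ with $e/k\notin\mathbb{Z}$. Let $N=\frac12\mathrm{diag}(1,-1)$, $E=\mathrm{id}$, $\psi^+=E_{12}$, $\psi^-=E_{21}$ be the standard basis of the Lie superalgebra $\mathfrak{gl}(1|1)$, and let $V_k(\mathfrak{gl}(1|1))$ be the universal affine vertex operator superalgebra of level $k$ for the supertrace form, with conformal vector $$\omega=\tfrac{1}{2k}\big(N_{-1}E_{-1}+E_{-1}N_{-1}-\psi^+_{-1}\psi^-_{-1}+\psi^-_{-1}\psi^+_{-1}\big)\mathbf 1+\tfrac{1}{2k^2}E_{-1}^2\mathbf 1 .$$ For $n,e\in\mathbb{C}$ let $\widehat V^k_{n,e}$ be the generalized Verma module of level $k$ generated by an even highest-weight vector $v_{n,e}$ with $a_r v_{n,e}=0$ for $a\in\mathfrak{gl}(1|1)$, $r>0$, and $\psi^+_0v_{n,e}=0$, $N_0v_{n,e}=(n+\frac12)v_{n,e}$, $E_0v_{n,e}=e\,v_{n,e}$; its lowest conformal weight is $\Delta=\Delta_{n,e}=\frac ek\left(n+\frac{e}{2k}\right)$. Let $V=\widehat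 V^k_{n,e}$ and let $V'$ be its contragredient, which is isomorphic to the parity-reversed module $\Pi(\widehat V^k_{-n,-e})$; thus $v_{-n,-e}\in V'$ is odd, and it has conformal weight $\Delta_{-n,-e}=\Delta$. Let $W$ be a grading-restricted generalized $V_k(\mathfrak{gl}(1|1))$-module, let $\mathcal Y_1$ be an even (possibly logarithmic) intertwining operator of type $\binom{V}{V\,W}$ and $\mathcal Y_2$ one of type $\binom{W}{V'\,V}$, and let $v_0\in V'$ be any vector of the lowest conformal weight $\Delta$. Let $U=\{z\in\mathbb{C}: |z|<1\}\setminus(-1,0]$, with the principal branches of $\log z$ and of powers of $z$ and $1-z$ (and $\log 1=0$). Then: 1. The series $$\phi(z)=\langle v_0,\mathcal Y_1(v_{n,e},1)\,\mathcal Y_2(v_{-n,-e},z)\,\psi^-_0v_{n,e}\rangle$$ converges absolutely for $z\in U$, and $\phi$ is analytic on $U$. 2. On $U$ the function $\phi$ satisfies $$z(1-z)\phi''+\big[(4\Delta+1)-(8\Delta+1)z\big]\phi'+4\Delta^2z^{-1}\phi+2\Delta(2\Delta-1)(1-z)^{-1}\phi+\Big[\big(\tfrac ek\big)^2-16\Delta^2\Big]\phi=0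 .$$ 3. This second-order equation is Fuchsian: its coefficients (after division by $z(1-z)$) are analytic on $\mathbb{C}\setminus\{0,1\}$, and $0$, $1$, $\infty$ are at worst regular singular points. 4. An analytic function $g$ on $U$ satisfies the equation in 2 at a point $z\in U$ if and only if $f(z)=z^{2\Delta}(1-z)^{2\Delta}g(z)$ satisfies there the hypergeometric equation with parameters $(e/k,-e/k;1)$, $$z(1-z)f''+(1-z)f'+\big(\tfrac ek\big)^2f=0 .$$ In particular, $z^{2\Delta}(1-z)^{2\Delta}\phi(z)$ satisfies this hypergeometric equation on $U$. -/

import Mathlib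

open Filter

namespace GL11

/-! ## The Lie superalgebra `gl(1|1)` -/

/-- The underlying space of `gl(1|1)`: endomorphisms of `ℂ^{1|1}`. -/
abbrev Gl : Type := Matrix (Fin 2) (Fin 2) ℂ

noncomputable def elN : Gl := !![1 / 2, 0; 0, -(1 / 2)]

noncomputable def elE : Gl := !![1, 0; 0, 1]

noncomputable def psiPlus : Gl := !![0, 1; 0, 0]

noncomputable def psiMinus : Gl := !![0, 0; 1, 0]

/-- The sign `(-1)^α` of a parity `α`. -/
noncomputable def sgn (α : ZMod 2) : ℂ := if α = 1 then -1 else 1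

/-- `a` is homogeneous of parity `α`: diagonal matrices are even, off-diagonal ones are odd. -/
def IsHomog (α : ZMod 2) (a : Gl) : Prop :=
  ∀ i j : Fin 2, a i j ≠ 0 → (((i : ℕ) + (j : ℕ) : ℕ) : ZMod 2) = α

/-- The superbracket `[a, b] = ab - (-1)^{|a||b|} ba` of homogeneous elements of parities
`α` and `β`. -/
noncomputable def superBracket (α β : ZMod 2) (a b : Gl) : Gl := a * b - sgn (α * β) • (b * a)

/-- The invariant form `κ(a, b) = str(ab)`; it satisfies `κ(N, E) = κ(E, N) = 1`,
`κ(ψ⁺, ψ⁻) = -κ(ψ⁻, ψ⁺) = 1`, and vanishes on all other pairs of basis elements. -/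
noncomputable def kappa (a b : Gl) : ℂ := (a * b) 0 0 - (a * b) 1 1

/-! ## Modules for `V_k(gl(1|1))` -/

/-- A (weak) module for the affine vertex operator superalgebra `V_k(gl(1|1))`, given by the modes
`a_r` of the fields `Y_W(a_{-1} 1, x) = ∑ a_r x^{-r-1}`, that is, a `ℤ/2`-graded module of level `k`
for the affine Lie superalgebra of `gl(1|1)` on which every vector is annihilated by all `a_r` with
`r` sufficiently large. (`V_k(gl(1|1))` is the universal affine vertex superalgebra, so that such
modules and `V_k(gl(1|1))`-modules are the same thing.) The `ℤ/2`-grading is encoded by the parity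
involution, which is `1` on the even part and `-1` on the odd part. -/
structure AffineModule (k : ℂ) (W : Type*) [AddCommGroup W] [Module ℂ W] where
  parity : Module.End ℂ W
  parity_parity : ∀ w, parity (parity w) = w
  mode : ℤ → Gl →ₗ[ℂ] Module.End ℂ W
  mode_parity : ∀ (α : ZMod 2) (a : Gl), IsHomog α a → ∀ (r : ℤ) (w : W),
    parity (mode r a w) = sgn α • mode r a (parity w)
  bracket : ∀ (α β : ZMod 2) (a b : Gl), IsHomog α a → IsHomog β b → ∀ (r s : ℤ) (w : W),
    mode r a (mode s b w) - sgn (α * β) • mode s b (mode r a w) =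
      mode (r + s) (superBracket α β a b) w +
        (if r + s = 0 then (r : ℂ) * kappa a b * k else 0) • w
  smooth : ∀ w : W, ∃ R : ℤ, ∀ r : ℤ, R ≤ r → ∀ a : Gl, mode r a w = 0

/-- The pointwise sum of a locally finite sequence of endomorphisms. -/
noncomputable def locSum {W : Type*} [AddCommGroup W] [Module ℂ W] (f : ℕ → Module.End ℂ W)
    (hf : ∀ w, ∃ R : ℕ, ∀ r : ℕ, R ≤ r → f r w = 0) : Module.End ℂ W where
  toFun w := ∑ᶠ r : ℕ, f r w
  map_add' v w := by
    have fin : ∀ u, (Function.support fun r : ℕ => f r u).Finite := fun u => by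
      obtain ⟨R, hR⟩ := hf u
      refine (Set.finite_lt_nat R).subset fun r hr => ?_
      by_contra h
      exact hr (hR r (not_lt.mp h))
    rw [← finsum_add_distrib (fin v) (fin w)]
    simp
  map_smul' c w := by
    simp only [map_smul, RingHom.id_apply]
    rw [smul_finsum]

namespace AffineModule

variable {k : ℂ} {W : Type*} [AddCommGroup W] [Module ℂ W]

/-- The homogeneous subspace of parity `α`. -/
noncomputable def part (M : AffineModule k W) (α : ZMod 2) : Submodule ℂ W :=
  LinearMap.ker (M.parity - sgn α • LinearMap.id)

/-- The parity-reversed module. -/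
def parityReverse (M : AffineModule k W) : AffineModule k W where
  parity := -M.parity
  parity_parity w := by simp [M.parity_parity]
  mode := M.mode
  mode_parity α a ha r w := by simp [M.mode_parity α a ha r w]
  bracket := M.bracket
  smooth := M.smooth

/-- The operator
`k⁻¹ (N_{-r-m} E_r + E_{-r-m} N_r - ψ⁺_{-r-m} ψ⁻_r + ψ⁻_{-r-m} ψ⁺_r) + k⁻² E_{-r-m} E_r`. -/
noncomputable def sugawaraTerm (M : AffineModule k W) (m r : ℤ) : Module.End ℂ W :=
  k⁻¹ • (M.mode (-r - m) elN * M.mode r elE + M.mode (-r - m) elE * M.mode r elN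
      - M.mode (-r - m) psiPlus * M.mode r psiMinus
      + M.mode (-r - m) psiMinus * M.mode r psiPlus)
    + (k ^ 2)⁻¹ • (M.mode (-r - m) elE * M.mode r elE)

theorem sugawaraTerm_locallyFinite (M : AffineModule k W) (m i : ℤ) (w : W) :
    ∃ R : ℕ, ∀ r : ℕ, R ≤ r → M.sugawaraTerm m (r + i) w = 0 := by
  obtain ⟨R, hR⟩ := M.smooth w
  refine ⟨(R - i).toNat, fun r hr => ?_⟩
  have h : R ≤ (r : ℤ) + i := by omega
  simp [sugawaraTerm, hR _ h]

/-- The Virasoro mode `L_{-1}` of the conformal vector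
`(2k)⁻¹ (N_{-1}E_{-1} + E_{-1}N_{-1} - ψ⁺_{-1}ψ⁻_{-1} + ψ⁻_{-1}ψ⁺_{-1}) 1 + (2k²)⁻¹ E_{-1}² 1`:
the sum over `r ≥ 0` of
`k⁻¹ (N_{-r-1} E_r + E_{-r-1} N_r - ψ⁺_{-r-1} ψ⁻_r + ψ⁻_{-r-1} ψ⁺_r) + k⁻² E_{-r-1} E_r`. -/
noncomputable def LMinusOne (M : AffineModule k W) : Module.End ℂ W :=
  locSum (fun r : ℕ => M.sugawaraTerm 1 (r + 0)) (M.sugawaraTerm_locallyFinite 1 0)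

/-- The Virasoro mode `L_0` of the same conformal vector: the sum over `r ≥ 1` of
`k⁻¹ (N_{-r} E_r + E_{-r} N_r - ψ⁺_{-r} ψ⁻_r + ψ⁻_{-r} ψ⁺_r) + k⁻² E_{-r} E_r`, plus
`k⁻¹ (N_0 E_0 - ψ⁺_0 ψ⁻_0) + (2k)⁻¹ E_0 + (2k²)⁻¹ E_0²`. -/
noncomputable def LZero (M : AffineModule k W) : Module.End ℂ W :=
  locSum (fun r : ℕ => M.sugawaraTerm 0 (r + 1)) (M.sugawaraTerm_locallyFinite 0 1)
    + k⁻¹ • (M.mode 0 elN * M.mode 0 elE - M.mode 0 psiPlus * M.mode 0 psiMinus)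
    + (2 * k)⁻¹ • M.mode 0 elE + (2 * k ^ 2)⁻¹ • (M.mode 0 elE * M.mode 0 elE)

/-- The space `W_[h]` of conformal weight `h`: the generalized eigenspace of `L_0`. -/
noncomputable def weightSpace (M : AffineModule k W) (h : ℂ) : Submodule ℂ W :=
  M.LZero.maxGenEigenspace h

/-- `W` is a grading-restricted generalized module: it is the direct sum of its conformal weight
spaces, these are finite dimensional, and for each `h` one has `W_[h-i] = 0` for all large `i`. -/
structure IsGradingRestricted (M : AffineModule k W) : Prop where
  isInternal : DirectSum.IsInternal M.weightSpace
  finiteDimensional : ∀ h, FiniteDimensional ℂ (M.weightSpace h)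
  lowerBounded : ∀ h : ℂ, ∀ᶠ i : ℕ in atTop, M.weightSpace (h - i) = ⊥

/-- The conformal weight space of weight `h` of the contragredient module, whose underlying space is
the graded dual `⊕_h (W_[h])^*`: the linear functionals that vanish on `W_[h']` for `h' ≠ h`. -/
noncomputable def contragredientWeightSpace (M : AffineModule k W) (h : ℂ) :
    Submodule ℂ (Module.Dual ℂ W) :=
  ⨅ h' : {x : ℂ // x ≠ h}, (M.weightSpace h').dualAnnihilator

end AffineModule

/-! ## The generalized Verma modules -/

/-- The defining relations of the universal enveloping algebra of the affine Lie superalgebra of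
`gl(1|1)`, with the central element set equal to `k`; the generator `(r, a)` is
`a_r = a ⊗ t^r`. -/
inductive EnvRel (k : ℂ) : FreeAlgebra ℂ (ℤ × Gl) → FreeAlgebra ℂ (ℤ × Gl) → Prop
  | add (r : ℤ) (a b : Gl) : EnvRel k (FreeAlgebra.ι ℂ (r, a + b))
      (FreeAlgebra.ι ℂ (r, a) + FreeAlgebra.ι ℂ (r, b))
  | smul (r : ℤ) (c : ℂ) (a : Gl) : EnvRel k (FreeAlgebra.ι ℂ (r, c • a))
      (c • FreeAlgebra.ι ℂ (r, a))
  | bracket (α β : ZMod 2) (a b : Gl) (ha : IsHomog α a) (hb : IsHomog β b) (r s : ℤ) :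
      EnvRel k (FreeAlgebra.ι ℂ (r, a) * FreeAlgebra.ι ℂ (s, b))
        (sgn (α * β) • (FreeAlgebra.ι ℂ (s, b) * FreeAlgebra.ι ℂ (r, a)) +
          FreeAlgebra.ι ℂ (r + s, superBracket α β a b) +
          algebraMap ℂ _ (if r + s = 0 then (r : ℂ) * kappa a b * k else 0))

/-- The enveloping algebra at level `k`. -/
def Env (k : ℂ) : Type := RingQuot (EnvRel k)

noncomputable instance (k : ℂ) : Ring (Env k) := inferInstanceAs (Ring (RingQuot (EnvRel k)))

noncomputable instance (k : ℂ) : Algebra ℂ (Env k) :=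
  inferInstanceAs (Algebra ℂ (RingQuot (EnvRel k)))

/-- The quotient map from the free algebra. -/
noncomputable def envMk (k : ℂ) : FreeAlgebra ℂ (ℤ × Gl) →ₐ[ℂ] Env k :=
  RingQuot.mkAlgHom ℂ (EnvRel k)

theorem envMk_rel {k : ℂ} {x y : FreeAlgebra ℂ (ℤ × Gl)} (h : EnvRel k x y) :
    envMk k x = envMk k y :=
  RingQuot.mkAlgHom_rel ℂ h

theorem envMk_surjective (k : ℂ) : Function.Surjective (envMk k) :=
  RingQuot.mkAlgHom_surjective ℂ (EnvRel k)

/-- The universal property of the enveloping algebra at level `k`. -/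
noncomputable def envLift {k : ℂ} {A : Type*} [Ring A] [Algebra ℂ A]
    (f : FreeAlgebra ℂ (ℤ × Gl) →ₐ[ℂ] A) (hf : ∀ ⦃x y⦄, EnvRel k x y → f x = f y) :
    Env k →ₐ[ℂ] A :=
  RingQuot.liftAlgHom ℂ ⟨f, hf⟩

theorem envLift_envMk {k : ℂ} {A : Type*} [Ring A] [Algebra ℂ A]
    (f : FreeAlgebra ℂ (ℤ × Gl) →ₐ[ℂ] A) (hf : ∀ ⦃x y⦄, EnvRel k x y → f x = f y)
    (x : FreeAlgebra ℂ (ℤ × Gl)) : envLift f hf (envMk k x) = f x :=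
  RingQuot.liftAlgHom_mkAlgHom_apply ℂ f hf x

/-- The element `a_r` of the enveloping algebra. -/
noncomputable def gen (k : ℂ) (r : ℤ) (a : Gl) : Env k :=
  envMk k (FreeAlgebra.ι ℂ (r, a))

/-- The left ideal annihilating the highest-weight vector `v_{n,e}`: `a_r` for `r > 0`, `ψ⁺_0`,
`N_0 - (n + 1/2)` and `E_0 - e`. -/
noncomputable def vermaIdeal (k n e : ℂ) : Submodule (Env k) (Env k) :=
  Submodule.span (Env k)
    ({x | ∃ (r : ℤ) (a : Gl), 0 < r ∧ x = gen k r a} ∪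
      {gen k 0 psiPlus, gen k 0 elN - algebraMap ℂ _ (n + 1 / 2),
        gen k 0 elE - algebraMap ℂ _ e})

/-- The underlying space of the generalized Verma module of level `k` induced from the
two-dimensional Verma module `V_{n,e}` of `gl(1|1)`, where `n` is the average of the two
eigenvalues of `N` on `V_{n,e}`. -/
abbrev Verma (k n e : ℂ) : Type := Env k ⧸ vermaIdeal k n e

/-- The highest-weight vector `v_{n,e}`. -/
noncomputable def hwVector (k n e : ℂ) : Verma k n e := Submodule.Quotient.mk 1

theorem gen_add (k : ℂ) (r : ℤ) (a b : Gl) : gen k r (a + b) = gen k r a + gen k r b := by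
  simpa [gen] using envMk_rel (EnvRel.add (k := k) r a b)

theorem gen_smul (k : ℂ) (r : ℤ) (c : ℂ) (a : Gl) : gen k r (c • a) = c • gen k r a := by
  simpa [gen] using envMk_rel (EnvRel.smul (k := k) r c a)

theorem gen_bracket (k : ℂ) (α β : ZMod 2) (a b : Gl) (ha : IsHomog α a) (hb : IsHomog β b)
    (r s : ℤ) : gen k r a * gen k s b = sgn (α * β) • (gen k s b * gen k r a) +
      gen k (r + s) (superBracket α β a b) +
      algebraMap ℂ (Env k) (if r + s = 0 then (r : ℂ) * kappa a b * k else 0) := by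
  have := envMk_rel (EnvRel.bracket (k := k) α β a b ha hb r s)
  rw [map_mul, map_add, map_add, map_smul, map_mul, AlgHom.commutes] at this
  exact this

/-- The parity automorphism of `gl(1|1)`. -/
noncomputable def theta : Gl →ₗ[ℂ] Gl where
  toFun a := !![a 0 0, -a 0 1; -a 1 0, a 1 1]
  map_add' a b := by
    ext i j; fin_cases i <;> fin_cases j <;> simp <;> ring
  map_smul' c a := by
    ext i j; fin_cases i <;> fin_cases j <;> simp

theorem theta_of_homog {α : ZMod 2} {a : Gl} (ha : IsHomog α a) : theta a = sgn α • a := by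
  have h00 := ha 0 0
  have h01 := ha 0 1
  have h10 := ha 1 0
  have h11 := ha 1 1
  have e2 : (2 : ZMod 2) = 0 := rfl
  have hc : ∀ x : ZMod 2, x = 0 ∨ x = 1 := by decide
  ext i j
  rcases hc α with rfl | rfl <;> fin_cases i <;> fin_cases j <;>
    simp_all [theta, sgn]

theorem theta_mul (a b : Gl) : theta (a * b) = theta a * theta b := by
  ext i j; fin_cases i <;> fin_cases j <;> simp [theta, Matrix.mul_apply, Fin.sum_univ_two] <;> ring

theorem theta_theta (a : Gl) : theta (theta a) = a := by
  ext i j; fin_cases i <;> fin_cases j <;> simp [theta]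

theorem kappa_theta (a b : Gl) : kappa (theta a) (theta b) = kappa a b := by
  simp [kappa, theta, Matrix.mul_apply, Fin.sum_univ_two]

theorem theta_homog {α : ZMod 2} {a : Gl} (ha : IsHomog α a) : IsHomog α (theta a) := by
  intro i j hij
  refine ha i j fun h => hij ?_
  rw [theta_of_homog ha]
  simp [h]

theorem theta_superBracket (α β : ZMod 2) (a b : Gl) :
    theta (superBracket α β a b) = superBracket α β (theta a) (theta b) := by
  simp [superBracket, theta_mul]

theorem isHomog_even_part (a : Gl) : IsHomog 0 !![a 0 0, 0; 0, a 1 1] := by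
  intro i j; fin_cases i <;> fin_cases j <;> simp
  intro _; rfl

theorem isHomog_odd_part (a : Gl) : IsHomog 1 !![0, a 0 1; a 1 0, 0] := by
  intro i j; fin_cases i <;> fin_cases j <;> simp

theorem even_add_odd (a : Gl) : a = !![a 0 0, 0; 0, a 1 1] + !![0, a 0 1; a 1 0, 0] := by
  ext i j; fin_cases i <;> fin_cases j <;> simp

/-- The parity automorphism of the enveloping algebra. -/
noncomputable def envParity (k : ℂ) : Env k →ₐ[ℂ] Env k :=
  envLift (FreeAlgebra.lift ℂ fun p : ℤ × Gl => gen k p.1 (theta p.2)) <| by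
    intro x y h
    induction h with
    | add r a b => simp [gen_add]
    | smul r c a => simp [gen_smul]
    | bracket α β a b ha hb r s =>
      simp only [map_mul, map_add, map_smul, FreeAlgebra.lift_ι_apply, AlgHom.commutes]
      rw [gen_bracket k α β _ _ (theta_homog ha) (theta_homog hb), theta_superBracket,
        kappa_theta]

theorem envParity_gen (k : ℂ) (r : ℤ) (a : Gl) :
    envParity k (gen k r a) = gen k r (theta a) := by
  simp [envParity, gen, envLift_envMk]

theorem env_induction {k : ℂ} {p : Env k → Prop} (x : Env k)
    (hone : p 1) (hsmul : ∀ (c : ℂ) x, p x → p (c • x)) (hadd : ∀ x y, p x → p y → p (x + y))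
    (hgen : ∀ r a x, p x → p (gen k r a * x)) : p x := by
  have key : ∀ (y : FreeAlgebra ℂ (ℤ × Gl)) (x : Env k), p x →
      p (envMk k y * x) := by
    intro y
    induction y using FreeAlgebra.induction with
    | grade0 c =>
      intro x hx
      rw [AlgHom.commutes, ← Algebra.smul_def]
      exact hsmul c x hx
    | grade1 q => exact fun x hx => hgen q.1 q.2 x hx
    | mul a b ha hb =>
      intro x hx
      rw [map_mul, mul_assoc]
      exact ha _ (hb _ hx)
    | add a b ha hb =>
      intro x hx
      rw [map_add, add_mul]
      exact hadd _ _ (ha _ hx) (hb _ hx)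
  obtain ⟨y, rfl⟩ := envMk_surjective k x
  simpa using key y 1 hone

theorem envParity_envParity (k : ℂ) (x : Env k) : envParity k (envParity k x) = x := by
  induction x using env_induction with
  | hone => simp
  | hsmul c x hx => simp [hx]
  | hadd x y hx hy => simp [hx, hy]
  | hgen r a x hx => simp [envParity_gen, hx, theta_theta]

theorem gen_mem_vermaIdeal {k n e : ℂ} {r : ℤ} (hr : 0 < r) (a : Gl) :
    gen k r a ∈ vermaIdeal k n e :=
  Submodule.subset_span (Or.inl ⟨r, a, hr, rfl⟩)

theorem envParity_mem {k n e : ℂ} {x : Env k} (hx : x ∈ vermaIdeal k n e) :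
    envParity k x ∈ vermaIdeal k n e := by
  have hN : theta elN = elN := by
    ext i j; fin_cases i <;> fin_cases j <;> simp [theta, elN]
  have hE : theta elE = elE := by
    ext i j; fin_cases i <;> fin_cases j <;> simp [theta, elE]
  have hP : theta psiPlus = (-1 : ℂ) • psiPlus := by
    ext i j; fin_cases i <;> fin_cases j <;> simp [theta, psiPlus]
  induction hx using Submodule.span_induction with
  | mem x hx =>
    rcases hx with ⟨r, a, hr, rfl⟩ | rfl | rfl | rfl
    · rw [envParity_gen]
      exact gen_mem_vermaIdeal hr _
    · rw [envParity_gen, hP, gen_smul]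
      refine Submodule.smul_of_tower_mem _ _ (Submodule.subset_span (Or.inr ?_))
      simp
    · rw [map_sub, envParity_gen, hN, AlgHom.commutes]
      exact Submodule.subset_span (Or.inr (by simp))
    · rw [map_sub, envParity_gen, hE, AlgHom.commutes]
      exact Submodule.subset_span (Or.inr (by simp))
  | zero => simp
  | add x y _ _ hx hy => rw [map_add]; exact add_mem hx hy
  | smul c x _ hx =>
    rw [smul_eq_mul, map_mul]
    exact Submodule.smul_mem _ _ hx

/-- The parity involution of the generalized Verma module; the highest-weight vector is even. -/
noncomputable def vermaParity (k n e : ℂ) : Module.End ℂ (Verma k n e) :=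
  Submodule.mapQ ((vermaIdeal k n e).restrictScalars ℂ) ((vermaIdeal k n e).restrictScalars ℂ)
    (envParity k).toLinearMap fun _ hx => envParity_mem hx

/-- The action of `a_r` on the generalized Verma module. -/
noncomputable def vermaMode (k n e : ℂ) (r : ℤ) : Gl →ₗ[ℂ] Module.End ℂ (Verma k n e) where
  toFun a := Algebra.lsmul ℂ ℂ (Verma k n e) (gen k r a)
  map_add' a b := by rw [gen_add, map_add]
  map_smul' c a := by rw [gen_smul, map_smul]; rfl

theorem vermaMode_mk (k n e : ℂ) (r : ℤ) (a : Gl) (x : Env k) :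
    vermaMode k n e r a (Submodule.Quotient.mk x) = Submodule.Quotient.mk (gen k r a * x) := rfl

theorem vermaParity_mk (k n e : ℂ) (x : Env k) :
    vermaParity k n e (Submodule.Quotient.mk x) = Submodule.Quotient.mk (envParity k x) := rfl

theorem verma_smooth (k n e : ℂ) (x : Env k) : ∃ R : ℤ, ∀ r : ℤ, R ≤ r → ∀ a : Gl,
    gen k r a * x ∈ vermaIdeal k n e := by
  induction x using env_induction with
  | hone =>
    refine ⟨1, fun r hr a => ?_⟩
    rw [mul_one]
    exact gen_mem_vermaIdeal (by omega) a
  | hsmul c x hx =>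
    obtain ⟨R, hR⟩ := hx
    refine ⟨R, fun r hr a => ?_⟩
    rw [mul_smul_comm]
    exact Submodule.smul_of_tower_mem _ _ (hR r hr a)
  | hadd x y hx hy =>
    obtain ⟨R, hR⟩ := hx
    obtain ⟨S, hS⟩ := hy
    refine ⟨max R S, fun r hr a => ?_⟩
    rw [mul_add]
    exact add_mem (hR r (le_trans (le_max_left _ _) hr) a) (hS r (le_trans (le_max_right _ _) hr) a)
  | hgen s b x hx =>
    obtain ⟨R, hR⟩ := hx
    have key : ∀ r : ℤ, max (max R (R - s)) (1 - s) ≤ r → ∀ (α β : ZMod 2) (a b : Gl),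
        IsHomog α a → IsHomog β b → gen k r a * (gen k s b * x) ∈ vermaIdeal k n e := by
      intro r hr α β a b ha hb
      have h1 : R ≤ r := by omega
      have h2 : R ≤ r + s := by omega
      have h3 : r + s ≠ 0 := by omega
      rw [← mul_assoc, gen_bracket k α β a b ha hb, if_neg h3, map_zero, add_zero, add_mul,
        smul_mul_assoc, mul_assoc]
      exact add_mem (Submodule.smul_of_tower_mem _ _ (Submodule.smul_mem _ _ (hR r h1 a)))
        (hR _ h2 _)
    refine ⟨max (max R (R - s)) (1 - s), fun r hr a => ?_⟩
    rw [even_add_odd a, even_add_odd b]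
    simp only [gen_add, add_mul, mul_add]
    have := key r hr
    exact add_mem
      (add_mem (this _ _ _ _ (isHomog_even_part a) (isHomog_even_part b))
        (this _ _ _ _ (isHomog_odd_part a) (isHomog_even_part b)))
      (add_mem (this _ _ _ _ (isHomog_even_part a) (isHomog_odd_part b))
        (this _ _ _ _ (isHomog_odd_part a) (isHomog_odd_part b)))

/-- The generalized Verma module as a `V_k(gl(1|1))`-module. -/
noncomputable def vermaModule (k n e : ℂ) : AffineModule k (Verma k n e) where
  parity := vermaParity k n e
  parity_parity w := by
    obtain ⟨x, rfl⟩ := Submodule.Quotient.mk_surjective _ w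
    rw [vermaParity_mk, vermaParity_mk, envParity_envParity]
  mode := vermaMode k n e
  mode_parity α a ha r w := by
    obtain ⟨x, rfl⟩ := Submodule.Quotient.mk_surjective _ w
    rw [vermaMode_mk, vermaParity_mk, vermaParity_mk, vermaMode_mk, map_mul, envParity_gen,
      theta_of_homog ha, gen_smul, smul_mul_assoc]
    rfl
  bracket α β a b ha hb r s w := by
    obtain ⟨x, rfl⟩ := Submodule.Quotient.mk_surjective _ w
    simp only [vermaMode_mk]
    rw [sub_eq_iff_eq_add, ← mul_assoc, gen_bracket k α β a b ha hb, add_mul, add_mul,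
      smul_mul_assoc, mul_assoc, ← Algebra.smul_def]
    simp only [Submodule.Quotient.mk_add, Submodule.Quotient.mk_smul]
    abel
  smooth w := by
    obtain ⟨x, rfl⟩ := Submodule.Quotient.mk_surjective _ w
    obtain ⟨R, hR⟩ := verma_smooth k n e x
    exact ⟨R, fun r hr a => (Submodule.Quotient.mk_eq_zero _).2 (hR r hr a)⟩

/-! ## Logarithmic intertwining operators -/

/-- An even (possibly logarithmic) intertwining operator of type `(W₃ over W₁ W₂)`:
`𝒴(w₁, x) w₂ = ∑_{p ∈ ℂ} ∑_{j ∈ ℕ} (w₁)_{p;j} w₂ x^{-p-1} (log x)^j`, where `coeff p j w₁ w₂`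
is `(w₁)_{p;j} w₂`. -/
structure EvenIntertwiningOperator {k : ℂ} {W₁ W₂ W₃ : Type*}
    [AddCommGroup W₁] [Module ℂ W₁] [AddCommGroup W₂] [Module ℂ W₂] [AddCommGroup W₃] [Module ℂ W₃]
    (M₁ : AffineModule k W₁) (M₂ : AffineModule k W₂) (M₃ : AffineModule k W₃) where
  coeff : ℂ → ℕ → W₁ →ₗ[ℂ] W₂ →ₗ[ℂ] W₃
  /-- Each power of `x` occurs with finitely many powers of `log x`. -/
  log_finite : ∀ (w₁ : W₁) (w₂ : W₂) (p : ℂ), ∀ᶠ j : ℕ in atTop, coeff p j w₁ w₂ = 0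
  /-- Lower truncation. -/
  lower_truncation : ∀ (w₁ : W₁) (w₂ : W₂) (p : ℂ),
    ∀ᶠ i : ℕ in atTop, ∀ j : ℕ, coeff (p + i) j w₁ w₂ = 0
  even : ∀ (p : ℂ) (j : ℕ) (w₁ : W₁) (w₂ : W₂),
    M₃.parity (coeff p j w₁ w₂) = coeff p j (M₁.parity w₁) (M₂.parity w₂)
  /-- The Jacobi identity for the fields `a(x) = ∑ a_r x^{-r-1}`, `a ∈ gl(1|1)`, which generate
  `V_k(gl(1|1))`, as the equality of the coefficients of its two sides. -/
  jacobi : ∀ (α β : ZMod 2) (a : Gl) (w₁ : W₁), IsHomog α a → w₁ ∈ M₁.part β →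
    ∀ (l m : ℤ) (p : ℂ) (j : ℕ) (w₂ : W₂),
      ∑ᶠ i : ℕ, ((-1 : ℂ) ^ i * (Ring.choose l i : ℂ)) •
          (M₃.mode (m + l - i) a (coeff (p + i) j w₁ w₂) -
            ((-1 : ℂ) ^ l * sgn (α * β)) • coeff (p + l - i) j w₁ (M₂.mode (m + i) a w₂)) =
        ∑ᶠ i : ℕ, (Ring.choose m i : ℂ) • coeff (p + m - i) j (M₁.mode (l + i) a w₁) w₂
  /-- `d/dx 𝒴(w₁, x) = 𝒴(L_{-1} w₁, x)`, as the equality of the coefficients of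
  `x^{-p-1} (log x)^j`. -/
  derivative : ∀ (w₁ : W₁) (w₂ : W₂) (p : ℂ) (j : ℕ),
    coeff p j (M₁.LMinusOne w₁) w₂ =
      -p • coeff (p - 1) j w₁ w₂ + ((j : ℂ) + 1) • coeff (p - 1) (j + 1) w₁ w₂

/-! ## Four-point functions -/

section Correlators

variable {k : ℂ} {W₀ W₁ W₂ W₃ W : Type*}
  [AddCommGroup W₀] [Module ℂ W₀] [AddCommGroup W₁] [Module ℂ W₁] [AddCommGroup W₂] [Module ℂ W₂]
  [AddCommGroup W₃] [Module ℂ W₃] [AddCommGroup W] [Module ℂ W]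
  {M₀ : AffineModule k W₀} {M₁ : AffineModule k W₁} {M₂ : AffineModule k W₂}
  {M₃ : AffineModule k W₃} {M : AffineModule k W}

/-- The terms of the series `⟨v₀, 𝒴₁(v₁, z₁) 𝒴₂(v₂, z₂) v₃⟩`, indexed by the exponents
`q = (p₁, j₁, p₂, j₂)` of `z₁^{-p₁-1} (log z₁)^{j₁} z₂^{-p₂-1} (log z₂)^{j₂}`, with the principal
branch of the logarithm. -/
noncomputable def productTerm (Y₁ : EvenIntertwiningOperator M₁ M M₀)
    (Y₂ : EvenIntertwiningOperator M₂ M₃ M) (v₀ : Module.Dual ℂ W₀) (v₁ : W₁) (v₂ : W₂) (v₃ : W₃)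
    (z₁ z₂ : ℂ) (q : (ℂ × ℕ) × (ℂ × ℕ)) : ℂ :=
  v₀ (Y₁.coeff q.1.1 q.1.2 v₁ (Y₂.coeff q.2.1 q.2.2 v₂ v₃)) *
    (z₁ ^ (-q.1.1 - 1) * Complex.log z₁ ^ q.1.2) * (z₂ ^ (-q.2.1 - 1) * Complex.log z₂ ^ q.2.2)

/-- The function `φ(z) = ⟨v₀, 𝒴₁(v₁, 1) 𝒴₂(v₂, z) v₃⟩`. -/
noncomputable def fourPoint (Y₁ : EvenIntertwiningOperator M₁ M M₀)
    (Y₂ : EvenIntertwiningOperator M₂ M₃ M) (v₀ : Module.Dual ℂ W₀) (v₁ : W₁) (v₂ : W₂) (v₃ : W₃)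
    (z : ℂ) : ℂ :=
  ∑' q, productTerm Y₁ Y₂ v₀ v₁ v₂ v₃ 1 z q

end Correlators

/-! ## Differential equations -/

/-- The region `{|z| < 1} \ (-1, 0]`. -/
def regionU : Set ℂ := Metric.ball 0 1 ∩ Complex.slitPlane

/-- `Δ_{n,e} = (e/k) (n + e/(2k))`. -/
noncomputable def Delta (k n e : ℂ) : ℂ := e / k * (n + e / (2 * k))

/-- `φ` satisfies at `z` the second-order equation with parameters `D = Δ_{n,e}` and `c = e/k`. -/
def MainEquation (D c : ℂ) (φ : ℂ → ℂ) (z : ℂ) : Prop :=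
  z * (1 - z) * deriv (deriv φ) z + ((4 * D + 1) - (8 * D + 1) * z) * deriv φ z
    + 4 * D ^ 2 * z⁻¹ * φ z + 2 * D * (2 * D - 1) * (1 - z)⁻¹ * φ z
    + (c ^ 2 - 16 * D ^ 2) * φ z = 0

/-- `f` satisfies at `z` the hypergeometric equation with parameters `(a, b; c)`. -/
def HypergeometricEquation (a b c : ℂ) (f : ℂ → ℂ) (z : ℂ) : Prop :=
  z * (1 - z) * deriv (deriv f) z + (c - (a + b + 1) * z) * deriv f z - a * b * f z = 0

/-- The equation `u'' + P u' + Q u = 0` has at `a` at worst a regular singular point: `P` has at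
most a simple pole and `Q` at most a double pole there. -/
def RegularAt (P Q : ℂ → ℂ) (a : ℂ) : Prop :=
  ∃ A B : ℂ → ℂ, AnalyticAt ℂ A a ∧ AnalyticAt ℂ B a ∧
    ∀ᶠ z in nhdsWithin a {a}ᶜ, (z - a) * P z = A z ∧ (z - a) ^ 2 * Q z = B z

/-- The equation `u'' + P u' + Q u = 0` is Fuchsian with singular points among `0`, `1`, `∞`: the
coefficients are analytic elsewhere, and `0`, `1` and `∞` are at worst regular singular points. At
`∞` this refers to the equation obtained by the substitution `z = 1/w`, at `w = 0`. -/
def IsFuchsianZeroOneInfty (P Q : ℂ → ℂ) : Prop :=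
  (∀ a : ℂ, a ≠ 0 → a ≠ 1 → AnalyticAt ℂ P a ∧ AnalyticAt ℂ Q a) ∧
    RegularAt P Q 0 ∧ RegularAt P Q 1 ∧
    RegularAt (fun w => 2 / w - P w⁻¹ / w ^ 2) (fun w => Q w⁻¹ / w ^ 4) 0

end GL11

/-!
The function `φ` is computed from its formal series. Write `v = v_{n,e}`, `w = ψ⁻_0 v`, and let `x`
and `y` be the series `⟨v₀, 𝒴₁(v, z₁) 𝒴₂(v', z₂) w⟩` and `⟨v₀, 𝒴₁(v, z₁) 𝒴₂(ψ⁻_0 v', z₂) v⟩`, where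
`v'` is the vector `v_{-n,-e}`; then `φ` is the value of `x` at `z₁ = 1`, `z₂ = z`.

*The functional `v₀`.* The relations of the affine Lie superalgebra give `[L_0, a_{-d}] = d a_{-d}`
(`AffineModule.LZero_mul_mode`), hence the conformal weights of the generalized Verma module lie in
`Δ + ℕ`. A functional of the lowest weight `Δ` therefore annihilates the images of the negative
modes (`contragredient_apply_mode_neg`), and `v₀ ∘ ψ⁻_0` only sees the eigenvalue `n + 1/2` of
`N_0` (`contragredient_apply_psiMinus`). The latter yields the Ward identity
`⟨v₀, 𝒴₁(w, z₁) 𝒴₂(v', z₂) v⟩ = x - y` (`corr_ward`).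

*The differential system.* The Jacobi identity gives the commutator and iterate formulas. Together
with the `L_{-1}`-derivative property and the Sugawara formula for `L_{-1}` they express `∂x/∂zᵢ`
and `∂y/∂zᵢ` by `x`, `y` and `x - y`: these are the Knizhnik–Zamolodchikov equations
(`corr_kz_right_x` and its companions). Their sum shows that the Euler operator `z₁ ∂₁ + z₂ ∂₂`
acts on `x` and `y` as `-2Δ`, and so, the powers of logarithms being bounded in each degree, `x`
and `y` are homogeneous of degree `-2Δ` (`corr_eq_zero_of_degree`). What remains is an ordinary
differential system in `z = z₂ / z₁` (`IsFormalSolution`) with a simple pole at `z = 0`.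

*Convergence.* The residue at `z = 0` is `-2Δ` plus a matrix of square zero. Hence only the
exponents in `-2Δ + ℕ` and at most one power of `log z` occur
(`IsFormalSolution.eq_zero_of_exponent`, `IsFormalSolution.eq_zero_of_two_le`). The recursion for
the coefficients has `m` on the left-hand side and a sum over the preceding coefficients on the
right-hand side, so that they grow subexponentially (`IsFormalSolution.subexponentialGrowth`) and
the series converges on the unit disc.

*The equations.* With `c = e/k`, `F = z^{2Δ} (1 - z)^{2Δ} x` and `G = z^{2Δ} (1 - z)^{2Δ} y` the
system reads `z F' = c (F - G)`, `z G' = c (F - G) + c z (1 - z)⁻¹ F`. Eliminating `G` gives the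
hypergeometric equation for `F` (`IsFormalSolution.hypergeometricEquation`), which the product rule
translates into the equation for `φ` (`mainEquation_iff`).
-/

namespace GL11

/-! ### The brackets of the basis modes -/

theorem sgn_zero : sgn 0 = 1 := by simp [sgn]

theorem sgn_one : sgn 1 = -1 := by simp [sgn]

theorem isHomog_elN : IsHomog 0 elN := by
  intro i j; fin_cases i <;> fin_cases j <;> simp [elN]
  rfl

theorem isHomog_elE : IsHomog 0 elE := by
  intro i j; fin_cases i <;> fin_cases j <;> simp [elE]
  rfl

theorem isHomog_psiPlus : IsHomog 1 psiPlus := by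
  intro i j; fin_cases i <;> fin_cases j <;> simp [psiPlus]

theorem isHomog_psiMinus : IsHomog 1 psiMinus := by
  intro i j; fin_cases i <;> fin_cases j <;> simp [psiMinus]

theorem gl_eq_basis (a : Gl) : a = (a 0 0 - a 1 1) • elN + ((a 0 0 + a 1 1) / 2) • elE
    + a 0 1 • psiPlus + a 1 0 • psiMinus := by
  ext i j; fin_cases i <;> fin_cases j <;> simp [elN, elE, psiPlus, psiMinus] <;> ring

theorem eq_zero_of_eq_neg {A : Type*} [AddCommGroup A] [Module ℂ A] {x : A} (h : x = -x) :
    x = 0 := by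
  have h2 : (2 : ℂ) • x = 0 := by rw [two_smul]; exact add_eq_zero_iff_eq_neg.mpr h
  exact (smul_eq_zero.mp h2).resolve_left two_ne_zero

theorem sum_range_shift_sub {A : Type*} [AddCommGroup A] (G : ℕ → A) (R d : ℕ) :
    ∑ i ∈ Finset.range R, (G (i + d) - G i) =
      ∑ i ∈ Finset.range d, G (R + i) - ∑ i ∈ Finset.range d, G i := by
  have h1 := Finset.sum_range_add G R d
  have h2 := Finset.sum_range_add G d R
  rw [add_comm d R, h1] at h2
  rw [Finset.sum_sub_distrib, sub_eq_sub_iff_add_eq_add]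
  simp only [add_comm _ d]
  rw [add_comm, ← h2, add_comm]

theorem locSum_eq_sum_range {W : Type*} [AddCommGroup W] [Module ℂ W]
    {f : ℕ → Module.End ℂ W}
    (hf : ∀ w, ∃ R : ℕ, ∀ r : ℕ, R ≤ r → f r w = 0) {w : W} {R : ℕ}
    (hR : ∀ r, R ≤ r → f r w = 0) : locSum f hf w = ∑ r ∈ Finset.range R, f r w := by
  change ∑ᶠ r : ℕ, f r w = _
  refine finsum_eq_sum_of_support_subset _ fun r hr => ?_
  by_contra h
  exact hr (hR r (by simpa using h))

theorem locSum_mul_comm {W : Type*} [AddCommGroup W] [Module ℂ W]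
    {f : ℕ → Module.End ℂ W}
    (hf : ∀ w, ∃ R : ℕ, ∀ r : ℕ, R ≤ r → f r w = 0) {A : Module.End ℂ W}
    (h : ∀ r, f r * A = A * f r) : locSum f hf * A = A * locSum f hf := by
  ext w
  obtain ⟨R, hR⟩ := hf w
  have h' : ∀ r, f r (A w) = A (f r w) := fun r => LinearMap.congr_fun (h r) w
  rw [Module.End.mul_apply, Module.End.mul_apply, locSum_eq_sum_range hf hR,
    locSum_eq_sum_range hf (w := A w) (R := R) fun r hr => by rw [h', hR r hr, map_zero],
    map_sum]
  exact Finset.sum_congr rfl fun r _ => h' r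

namespace AffineModule

variable {k : ℂ} {W : Type*} [AddCommGroup W] [Module ℂ W] (M : AffineModule k W)

/-- The bracket relation of the affine Lie superalgebra as an identity of operators. -/
theorem mode_mul_mode {α β : ZMod 2} {a b c : Gl} {t u : ℂ} (ha : IsHomog α a) (hb : IsHomog β b)
    (ht : sgn (α * β) = t) (hc : superBracket α β a b = c) (hu : kappa a b = u) (r s : ℤ) :
    M.mode r a * M.mode s b = t • (M.mode s b * M.mode r a) + M.mode (r + s) c
      + (if r + s = 0 then (r : ℂ) * u * k else 0) • 1 := by
  subst ht hc hu
  ext w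
  have := M.bracket α β a b ha hb r s w
  rw [sub_eq_iff_eq_add] at this
  simp only [Module.End.mul_apply, LinearMap.add_apply, LinearMap.smul_apply, this,
    Module.End.one_apply]
  abel

theorem mode_N_N (r s : ℤ) : M.mode r elN * M.mode s elN = M.mode s elN * M.mode r elN := by
  rw [M.mode_mul_mode (t := 1) (c := 0) (u := 0) isHomog_elN isHomog_elN]
  · simp
  · simp [sgn]
  · simp [superBracket, sgn]
  · simp [kappa, elN]

theorem mode_E_N (r s : ℤ) : M.mode r elE * M.mode s elN = M.mode s elN * M.mode r elE
    + (if r + s = 0 then (r : ℂ) * k else 0) • 1 := by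
  rw [M.mode_mul_mode (t := 1) (c := 0) (u := 1) isHomog_elE isHomog_elN]
  · simp
  · simp [sgn]
  · simp [superBracket, sgn, elE, elN]
  · simp [kappa, elE, elN]; norm_num

theorem mode_psiPlus_N (r s : ℤ) : M.mode r psiPlus * M.mode s elN =
    M.mode s elN * M.mode r psiPlus - M.mode (r + s) psiPlus := by
  rw [M.mode_mul_mode (t := 1) (c := -psiPlus) (u := 0) isHomog_psiPlus isHomog_elN]
  · simp [sub_eq_add_neg]
  · simp [sgn]
  · ext i j; fin_cases i <;> fin_cases j <;> simp [superBracket, sgn, psiPlus, elN]; norm_num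
  · simp [kappa, psiPlus, elN]

theorem mode_psiMinus_N (r s : ℤ) : M.mode r psiMinus * M.mode s elN =
    M.mode s elN * M.mode r psiMinus + M.mode (r + s) psiMinus := by
  rw [M.mode_mul_mode (t := 1) (c := psiMinus) (u := 0) isHomog_psiMinus isHomog_elN]
  · simp
  · simp [sgn]
  · ext i j; fin_cases i <;> fin_cases j <;> simp [superBracket, sgn, psiMinus, elN]; norm_num
  · simp [kappa, psiMinus, elN]

theorem mode_psiPlus_E (r s : ℤ) : M.mode r psiPlus * M.mode s elE =
    M.mode s elE * M.mode r psiPlus := by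
  rw [M.mode_mul_mode (t := 1) (c := 0) (u := 0) isHomog_psiPlus isHomog_elE]
  · simp
  · simp [sgn]
  · ext i j; fin_cases i <;> fin_cases j <;> simp [superBracket, sgn, psiPlus, elE]
  · simp [kappa, psiPlus, elE]

theorem mode_psiMinus_E (r s : ℤ) : M.mode r psiMinus * M.mode s elE =
    M.mode s elE * M.mode r psiMinus := by
  rw [M.mode_mul_mode (t := 1) (c := 0) (u := 0) isHomog_psiMinus isHomog_elE]
  · simp
  · simp [sgn]
  · ext i j; fin_cases i <;> fin_cases j <;> simp [superBracket, sgn, psiMinus, elE]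
  · simp [kappa, psiMinus, elE]

theorem mode_psiPlus_psiPlus (r s : ℤ) : M.mode r psiPlus * M.mode s psiPlus =
    -(M.mode s psiPlus * M.mode r psiPlus) := by
  rw [M.mode_mul_mode (t := -1) (c := 0) (u := 0) isHomog_psiPlus isHomog_psiPlus]
  · simp
  · simp [sgn]
  · simp [superBracket, sgn, psiPlus]
  · simp [kappa, psiPlus]

theorem mode_psiMinus_psiMinus (r s : ℤ) : M.mode r psiMinus * M.mode s psiMinus =
    -(M.mode s psiMinus * M.mode r psiMinus) := by
  rw [M.mode_mul_mode (t := -1) (c := 0) (u := 0) isHomog_psiMinus isHomog_psiMinus]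
  · simp
  · simp [sgn]
  · simp [superBracket, sgn, psiMinus]
  · simp [kappa, psiMinus]

theorem mode_psiPlus_psiMinus (r s : ℤ) : M.mode r psiPlus * M.mode s psiMinus =
    -(M.mode s psiMinus * M.mode r psiPlus) + M.mode (r + s) elE
      + (if r + s = 0 then (r : ℂ) * k else 0) • 1 := by
  rw [M.mode_mul_mode (t := -1) (c := elE) (u := 1) isHomog_psiPlus isHomog_psiMinus]
  · simp
  · simp [sgn]
  · ext i j; fin_cases i <;> fin_cases j <;>
      simp [superBracket, sgn, psiPlus, psiMinus, elE]
  · simp [kappa, psiPlus, psiMinus]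

/-! ### The Sugawara operator `L_0` -/

/-- The Casimir element is invariant, so that the zero modes commute with each summand of `L_0`. -/
theorem sugawaraTerm_zero_mul_psiPlus (r : ℤ) :
    M.sugawaraTerm 0 r * M.mode 0 psiPlus = M.mode 0 psiPlus * M.sugawaraTerm 0 r := by
  have hN := fun s => M.mode_psiPlus_N 0 s
  have hE := fun s => M.mode_psiPlus_E 0 s
  have hP := fun s => M.mode_psiPlus_psiPlus 0 s
  have hM := fun s => M.mode_psiPlus_psiMinus 0 s
  simp only [zero_add, Int.cast_zero, zero_mul, ite_self, zero_smul, add_zero] at hN hM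
  simp only [sugawaraTerm, sub_zero]
  simp only [mul_add, add_mul, mul_sub, sub_mul, smul_mul_assoc, mul_smul_comm, ← mul_assoc,
    hN, hE, hP, hM]
  simp only [mul_add, mul_sub, mul_assoc, hN, hE, hP, hM, neg_mul, mul_neg]
  congr 2
  abel

theorem sugawaraTerm_zero_mul_psiMinus (r : ℤ) :
    M.sugawaraTerm 0 r * M.mode 0 psiMinus = M.mode 0 psiMinus * M.sugawaraTerm 0 r := by
  have hN := fun s => M.mode_psiMinus_N 0 s
  have hE := fun s => M.mode_psiMinus_E 0 s
  have hM := fun s => M.mode_psiMinus_psiMinus 0 s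
  have hP : ∀ s, M.mode 0 psiMinus * M.mode s psiPlus =
      -(M.mode s psiPlus * M.mode 0 psiMinus) + M.mode s elE := fun s => by
    have h := M.mode_psiPlus_psiMinus s 0
    have h0 : (if s + 0 = 0 then (s : ℂ) * k else 0) = 0 := by
      split_ifs with hs
      · simp [show s = 0 by omega]
      · rfl
    rw [h0] at h
    rw [h]
    simp
  simp only [zero_add] at hN
  simp only [sugawaraTerm, sub_zero]
  simp only [mul_add, add_mul, mul_sub, sub_mul, smul_mul_assoc, mul_smul_comm, ← mul_assoc,
    hN, hE, hP, hM]
  simp only [mul_add, mul_assoc, hN, hE, hP, hM, neg_mul, mul_neg]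
  congr 2
  abel

theorem LZero_mul_psiPlus : M.LZero * M.mode 0 psiPlus = M.mode 0 psiPlus * M.LZero := by
  have h := locSum_mul_comm (M.sugawaraTerm_locallyFinite 0 1)
    fun r => M.sugawaraTerm_zero_mul_psiPlus (r + 1)
  have hN := M.mode_psiPlus_N 0 0
  have hE := M.mode_psiPlus_E 0 0
  have hP := M.mode_psiPlus_psiPlus 0 0
  have hM := M.mode_psiPlus_psiMinus 0 0
  simp only [Int.cast_zero, zero_mul, ite_self, zero_smul, add_zero] at hN hM
  have hPP := eq_zero_of_eq_neg hP
  have hz : (M.mode 0 elN * M.mode 0 elE - M.mode 0 psiPlus * M.mode 0 psiMinus) * M.mode 0 psiPlus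
      = M.mode 0 psiPlus *
        (M.mode 0 elN * M.mode 0 elE - M.mode 0 psiPlus * M.mode 0 psiMinus) := by
    have h1 : M.mode 0 psiMinus * M.mode 0 psiPlus
        = M.mode 0 elE - M.mode 0 psiPlus * M.mode 0 psiMinus := by
      rw [hM]; abel
    rw [sub_mul, mul_sub, ← mul_assoc, ← mul_assoc, hPP, zero_mul, mul_assoc, mul_assoc, h1, hN,
      sub_mul, mul_sub, ← mul_assoc (M.mode 0 psiPlus) (M.mode 0 psiPlus), hPP, ← hE, mul_assoc]
    simp
  simp only [LZero, add_mul, mul_add, smul_mul_assoc, mul_smul_comm, hz]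
  rw [h, mul_assoc (M.mode 0 elE), ← hE, ← mul_assoc, ← hE, mul_assoc]

theorem LZero_mul_psiMinus : M.LZero * M.mode 0 psiMinus = M.mode 0 psiMinus * M.LZero := by
  have h := locSum_mul_comm (M.sugawaraTerm_locallyFinite 0 1)
    fun r => M.sugawaraTerm_zero_mul_psiMinus (r + 1)
  have hN := M.mode_psiMinus_N 0 0
  have hE := M.mode_psiMinus_E 0 0
  have hP := M.mode_psiMinus_psiMinus 0 0
  have hM := M.mode_psiPlus_psiMinus 0 0
  simp only [Int.cast_zero, zero_mul, ite_self, zero_smul, add_zero] at hN hM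
  have hPP := eq_zero_of_eq_neg hP
  have hz : (M.mode 0 elN * M.mode 0 elE - M.mode 0 psiPlus * M.mode 0 psiMinus) * M.mode 0 psiMinus
      = M.mode 0 psiMinus *
        (M.mode 0 elN * M.mode 0 elE - M.mode 0 psiPlus * M.mode 0 psiMinus) := by
    rw [sub_mul, mul_sub, mul_assoc, mul_assoc, hPP, mul_zero, ← hE, hM, mul_add,
      ← mul_assoc, ← mul_assoc, hN, mul_neg, ← mul_assoc, hPP, add_mul]
    simp
  simp only [LZero, add_mul, mul_add, smul_mul_assoc, mul_smul_comm, hz]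
  rw [h, mul_assoc (M.mode 0 elE), ← hE, ← mul_assoc, ← hE, mul_assoc]

/-- The bracket of a summand of `L_0` with `N_{-d}`; the `ψ`-part has the form
`g r - g (r - d) + f r - f (r - d)`, so that it telescopes in the sum over `r`. -/
theorem sugawaraTerm_zero_mul_N (r : ℤ) (hr : 0 < r) (d : ℕ) (hk : k ≠ 0) :
    M.sugawaraTerm 0 r * M.mode (-d) elN = M.mode (-d) elN * M.sugawaraTerm 0 r
      + (if r = d then (d : ℂ) else 0) • (M.mode (-d) elN + k⁻¹ • M.mode (-d) elE)
      + k⁻¹ • (M.mode (-d - r) psiPlus * M.mode r psiMinus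
          - M.mode (-d - (r - d)) psiPlus * M.mode (r - d) psiMinus
        + (M.mode (-d - r) psiMinus * M.mode r psiPlus
          - M.mode (-d - (r - d)) psiMinus * M.mode (r - d) psiPlus)) := by
  have hE : M.mode r elE * M.mode (-d) elN = M.mode (-d) elN * M.mode r elE
      + (if r = d then (d : ℂ) * k else 0) • 1 := by
    rw [M.mode_E_N]
    congr 2
    by_cases h : r = d
    · simp [h]
    · rw [if_neg h, if_neg (by omega)]
  have hE' : M.mode (-r) elE * M.mode (-d) elN = M.mode (-d) elN * M.mode (-r) elE := by
    rw [M.mode_E_N, if_neg (by omega), zero_smul, add_zero]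
  have hP := M.mode_psiPlus_N r (-d)
  have hP' := M.mode_psiPlus_N (-r) (-d)
  have hM := M.mode_psiMinus_N r (-d)
  have hM' := M.mode_psiMinus_N (-r) (-d)
  have hN := M.mode_N_N r (-d)
  have hN' := M.mode_N_N (-r) (-d)
  have e1 : -(d : ℤ) - r = -r + -d := by ring
  have e2 : -(d : ℤ) - (r - d) = -r := by ring
  have e3 : r - (d : ℤ) = r + -d := by ring
  rw [e1, e2, e3]
  -- the central term comes with `N_{-r}` and `E_{-r}`, but occurs only for `r = d`
  have hmain : M.sugawaraTerm 0 r * M.mode (-d) elN = M.mode (-d) elN * M.sugawaraTerm 0 r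
      + (if r = d then (d : ℂ) * k else 0) •
        (k⁻¹ • M.mode (-r) elN + (k ^ 2)⁻¹ • M.mode (-r) elE)
      + k⁻¹ • (M.mode (-r + -d) psiPlus * M.mode r psiMinus
          - M.mode (-r) psiPlus * M.mode (r + -d) psiMinus
        + (M.mode (-r + -d) psiMinus * M.mode r psiPlus
          - M.mode (-r) psiMinus * M.mode (r + -d) psiPlus)) := by
    simp only [sugawaraTerm, sub_zero]
    simp only [mul_add, add_mul, mul_sub, sub_mul, smul_mul_assoc, mul_smul_comm, mul_assoc,
      hE, hP, hM, hN]
    simp only [add_mul, sub_mul, ← mul_assoc, hE', hP', hM', hN', mul_one]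
    module
  rw [hmain]
  congr 2
  by_cases h : r = d
  · subst h
    simp only [if_true, smul_add, smul_smul]
    congr 2
    · field_simp
    · field_simp
  · simp [h]

/-- `[L_0, N_{-d}] = d N_{-d}` for `d ≥ 0`. -/
theorem LZero_mul_N (d : ℕ) (hk : k ≠ 0) :
    M.LZero * M.mode (-d) elN = M.mode (-d) elN * M.LZero + (d : ℂ) • M.mode (-d) elN := by
  ext w
  obtain ⟨R₁, hR₁⟩ := M.smooth w
  obtain ⟨R₂, hR₂⟩ := M.smooth (M.mode (-d) elN w)
  obtain ⟨R, hR₁', hR₂', hRd⟩ : ∃ R : ℕ, R₁ + d ≤ R ∧ R₂ ≤ R ∧ d ≤ R :=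
    ⟨R₁.toNat + R₂.toNat + d, by omega, by omega, by omega⟩
  have hw : ∀ r : ℤ, R - d ≤ r → ∀ a, M.mode r a w = 0 := fun r hr a => hR₁ r (by omega) a
  have hw' : ∀ r : ℤ, R ≤ r → ∀ a, M.mode r a (M.mode (-d) elN w) = 0 :=
    fun r hr a => hR₂ r (by omega) a
  set g : ℤ → W := fun r => M.mode (-d - r) psiPlus (M.mode r psiMinus w) with hg
  set f : ℤ → W := fun r => M.mode (-d - r) psiMinus (M.mode r psiPlus w) with hf
  have hterm : ∀ r : ℕ, M.sugawaraTerm 0 (r + 1) (M.mode (-d) elN w)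
      = M.mode (-d) elN (M.sugawaraTerm 0 (r + 1) w)
        + (if r + 1 = d then (d : ℂ) else 0) • (M.mode (-d) elN w + k⁻¹ • M.mode (-d) elE w)
        + k⁻¹ • (g (r + 1) - g (r + 1 - d) + (f (r + 1) - f (r + 1 - d))) := fun r => by
    have h := LinearMap.congr_fun (M.sugawaraTerm_zero_mul_N (r + 1) (by omega) d hk) w
    have hc : ((r : ℤ) + 1 = d) ↔ (r + 1 = d) := by norm_cast
    simpa only [Module.End.mul_apply, LinearMap.add_apply, LinearMap.smul_apply,
      LinearMap.sub_apply, hc] using h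
  have hzero : M.mode 0 psiPlus (M.mode 0 psiMinus (M.mode (-d) elN w)) =
      M.mode (-d) elN (M.mode 0 psiPlus (M.mode 0 psiMinus w)) - (g 0 - g (0 - d)) := by
    have h1 := LinearMap.congr_fun (M.mode_psiMinus_N 0 (-d)) w
    have h2 := LinearMap.congr_fun (M.mode_psiPlus_N 0 (-d)) (M.mode 0 psiMinus w)
    simp only [Module.End.mul_apply, LinearMap.add_apply, LinearMap.sub_apply] at h1 h2
    rw [h1, map_add, h2]
    simp [hg]
    abel
  have hE : ∀ u, M.mode 0 elE (M.mode (-d) elN u) = M.mode (-d) elN (M.mode 0 elE u) := fun u => by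
    simpa using LinearMap.congr_fun (M.mode_E_N 0 (-d)) u
  have hN : ∀ u, M.mode 0 elN (M.mode (-d) elN u) = M.mode (-d) elN (M.mode 0 elN u) := fun u =>
    LinearMap.congr_fun (M.mode_N_N 0 (-d)) u
  have hsum : ∑ r ∈ Finset.range R, M.sugawaraTerm 0 (r + 1) (M.mode (-d) elN w)
      = M.mode (-d) elN (∑ r ∈ Finset.range R, M.sugawaraTerm 0 (r + 1) w)
        + (d : ℂ) • (M.mode (-d) elN w + k⁻¹ • M.mode (-d) elE w)
        + k⁻¹ • (∑ r ∈ Finset.range R, (g (r + 1) - g (r + 1 - d))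
          + ∑ r ∈ Finset.range R, (f (r + 1) - f (r + 1 - d))) := by
    rw [Finset.sum_congr rfl fun r _ => hterm r, Finset.sum_add_distrib, Finset.sum_add_distrib,
      map_sum, ← Finset.sum_smul, ← Finset.smul_sum, ← Finset.sum_add_distrib]
    congr 3
    rcases Nat.eq_zero_or_pos d with rfl | hd
    · simp
    rw [Finset.sum_eq_single (d - 1)]
    · rw [if_pos (by omega)]
    · intro b _ hb
      rw [if_neg (by omega)]
    · intro h
      exact absurd (Finset.mem_range.mpr (by omega)) h
  -- the two telescoping sums, the first one completed by the contribution of the zero modes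
  have htg : g 0 - g (0 - d) + ∑ r ∈ Finset.range R, (g (r + 1) - g (r + 1 - d))
      = - ∑ i ∈ Finset.range d, g (i - d) := by
    have h := sum_range_shift_sub (fun i : ℕ => g (i - d)) (R + 1) d
    rw [Finset.sum_range_succ', Finset.sum_eq_zero (s := Finset.range d)
      (f := fun i => g (((R + 1 + i : ℕ) : ℤ) - d)), zero_sub] at h
    · rw [← h, add_comm]
      push_cast
      simp
    · intro i _
      simp only [hg]
      rw [hw _ (by omega), map_zero]
  have htf : ∑ r ∈ Finset.range R, (f (r + 1) - f (r + 1 - d))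
      = - ∑ i ∈ Finset.range d, f (i + 1 - d) := by
    have h := sum_range_shift_sub (fun i : ℕ => f (i + 1 - d)) R d
    rw [Finset.sum_eq_zero (s := Finset.range d)
      (f := fun i => f (((R + i : ℕ) : ℤ) + 1 - d)), zero_sub] at h
    · rw [← h]
      refine Finset.sum_congr rfl fun r _ => ?_
      push_cast
      congr 2
      ring
    · intro i _
      simp only [hf]
      rw [hw _ (by omega), map_zero]
  -- what remains of the two sums pairs to the brackets `{ψ⁺_{-i}, ψ⁻_{i-d}} = E_{-d}`
  have hpair : ∑ i ∈ Finset.range d, g (i - d) + ∑ i ∈ Finset.range d, f (i + 1 - d)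
      = (d : ℂ) • M.mode (-d) elE w := by
    rw [← Finset.sum_range_reflect (fun i : ℕ => f (i + 1 - d)), ← Finset.sum_add_distrib,
      Finset.sum_congr rfl (g := fun _ => M.mode (-d) elE w)]
    · simp [Nat.cast_smul_eq_nsmul]
    · intro i hi
      have hi' := Finset.mem_range.mp hi
      have e1 : ((d - 1 - i : ℕ) : ℤ) + 1 - d = -i := by omega
      have h := LinearMap.congr_fun (M.mode_psiPlus_psiMinus (-i) (i - d)) w
      rw [e1]
      simp only [hg, hf]
      have e2 : -(d : ℤ) - (i - d) = -i := by ring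
      have e3 : -(d : ℤ) - -i = i - d := by ring
      have e4 : -(i : ℤ) + (i - d) = -d := by ring
      rw [e4, if_neg (by omega)] at h
      simp only [Module.End.mul_apply, LinearMap.add_apply, LinearMap.neg_apply] at h
      rw [e2, e3, h]
      simp
  have hL : ∀ u, (∀ r : ℤ, R ≤ r → ∀ a, M.mode r a u = 0) → M.LZero u =
      ∑ r ∈ Finset.range R, M.sugawaraTerm 0 (r + 1) u
        + k⁻¹ • (M.mode 0 elN (M.mode 0 elE u) - M.mode 0 psiPlus (M.mode 0 psiMinus u))
        + (2 * k)⁻¹ • M.mode 0 elE u + (2 * k ^ 2)⁻¹ • M.mode 0 elE (M.mode 0 elE u) := by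
    intro u hu
    simp only [LZero, LinearMap.add_apply, LinearMap.smul_apply, LinearMap.sub_apply,
      Module.End.mul_apply]
    rw [locSum_eq_sum_range]
    intro r hr
    simp [sugawaraTerm, hu ((r : ℤ) + 1) (by omega)]
  simp only [Module.End.mul_apply, LinearMap.add_apply, LinearMap.smul_apply]
  rw [hL _ hw', hL _ fun r hr => hw r (by omega), hsum, hzero, hE, hE, hN]
  simp only [map_add, map_sub, map_smul]
  have htot := congrArg₂ (· + ·) htg htf
  rw [← neg_add, hpair] at htot
  linear_combination (norm := module) k⁻¹ • htot

/-- `[L_0, a_{-d}] = d a_{-d}`. The elements `N_{-d}` and `ψ^±_0` generate all `a_{-d}` under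
brackets, so that only these enter the computation with the Sugawara operator. -/
theorem LZero_mul_mode (hk : k ≠ 0) (d : ℕ) (a : Gl) :
    M.LZero * M.mode (-d) a = M.mode (-d) a * M.LZero + (d : ℂ) • M.mode (-d) a := by
  rcases Nat.eq_zero_or_pos d with rfl | hd
  · have hP := M.LZero_mul_psiPlus
    have hM := M.LZero_mul_psiMinus
    have hE : M.LZero * M.mode 0 elE = M.mode 0 elE * M.LZero := by
      have h : M.mode 0 elE =
          M.mode 0 psiPlus * M.mode 0 psiMinus + M.mode 0 psiMinus * M.mode 0 psiPlus := by
        rw [M.mode_psiPlus_psiMinus]; simp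
      rw [h, mul_add, add_mul, ← mul_assoc, ← mul_assoc, hP, hM, mul_assoc, mul_assoc, hP, hM,
        ← mul_assoc, ← mul_assoc]
    have hN : M.LZero * M.mode 0 elN = M.mode 0 elN * M.LZero := by
      simpa using M.LZero_mul_N 0 hk
    simp only [Nat.cast_zero, neg_zero, zero_smul, add_zero]
    rw [gl_eq_basis a]
    simp only [map_add, map_smul, mul_add, add_mul, mul_smul_comm, smul_mul_assoc, hP, hM, hE, hN]
  · have hN := M.LZero_mul_N d hk
    have hP : M.LZero * M.mode (-d) psiPlus =
        M.mode (-d) psiPlus * M.LZero + (d : ℂ) • M.mode (-d) psiPlus := by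
      have h : M.mode (-d) psiPlus =
          M.mode (-d) elN * M.mode 0 psiPlus - M.mode 0 psiPlus * M.mode (-d) elN := by
        rw [M.mode_psiPlus_N]; simp
      rw [h, mul_sub, ← mul_assoc, hN, ← mul_assoc, LZero_mul_psiPlus, mul_assoc _ M.LZero, hN,
        add_mul, mul_assoc, LZero_mul_psiPlus]
      simp only [mul_add, sub_mul, ← mul_assoc, smul_sub, smul_mul_assoc, mul_smul_comm]
      abel
    have hM : M.LZero * M.mode (-d) psiMinus =
        M.mode (-d) psiMinus * M.LZero + (d : ℂ) • M.mode (-d) psiMinus := by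
      have h : M.mode (-d) psiMinus =
          M.mode 0 psiMinus * M.mode (-d) elN - M.mode (-d) elN * M.mode 0 psiMinus := by
        rw [M.mode_psiMinus_N]; simp
      rw [h, mul_sub, ← mul_assoc, LZero_mul_psiMinus, ← mul_assoc, hN, mul_assoc _ M.LZero, hN,
        add_mul, mul_assoc _ M.LZero, LZero_mul_psiMinus]
      simp only [mul_add, sub_mul, ← mul_assoc, smul_sub, smul_mul_assoc, mul_smul_comm]
      abel
    have hE : M.LZero * M.mode (-d) elE =
        M.mode (-d) elE * M.LZero + (d : ℂ) • M.mode (-d) elE := by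
      have h : M.mode (-d) elE =
          M.mode (-d) psiPlus * M.mode 0 psiMinus + M.mode 0 psiMinus * M.mode (-d) psiPlus := by
        rw [M.mode_psiPlus_psiMinus, if_neg (by omega)]; simp
      rw [h, mul_add, ← mul_assoc, hP, ← mul_assoc, LZero_mul_psiMinus, mul_assoc _ M.LZero, hP,
        add_mul, mul_assoc _ M.LZero, LZero_mul_psiMinus]
      simp only [mul_add, add_mul, ← mul_assoc, smul_add, smul_mul_assoc, mul_smul_comm]
      abel
    rw [gl_eq_basis a]
    simp only [map_add, map_smul, mul_add, add_mul, mul_smul_comm, smul_mul_assoc, hP, hM, hE, hN,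
      smul_add]
    module

/-- A subspace that contains `c_{r+s} y`, `b_s c_r y` and, if the central term occurs, `y` also
contains `a_r b_s y`. -/
theorem mode_mode_mem {S : Submodule ℂ W} {r s : ℤ} {y : W} (h₁ : ∀ c, M.mode (r + s) c y ∈ S)
    (h₂ : ∀ b c, M.mode s b (M.mode r c y) ∈ S) (h₃ : r + s ≠ 0 ∨ y ∈ S) (a b : Gl) :
    M.mode r a (M.mode s b y) ∈ S := by
  have key : ∀ (α β : ZMod 2) (a b : Gl), IsHomog α a → IsHomog β b →
      M.mode r a (M.mode s b y) ∈ S := by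
    intro α β a b ha hb
    have h := M.bracket α β a b ha hb r s y
    rw [sub_eq_iff_eq_add] at h
    rw [h]
    refine S.add_mem (S.add_mem (h₁ _) ?_) (S.smul_mem _ (h₂ _ _))
    rcases h₃ with h₃ | h₃
    · rw [if_neg h₃, zero_smul]
      exact S.zero_mem
    · exact S.smul_mem _ h₃
  rw [even_add_odd a, even_add_odd b]
  simp only [map_add, LinearMap.add_apply]
  exact S.add_mem
    (S.add_mem (key _ _ _ _ (isHomog_even_part a) (isHomog_even_part b))
      (key _ _ _ _ (isHomog_odd_part a) (isHomog_even_part b)))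
    (S.add_mem (key _ _ _ _ (isHomog_even_part a) (isHomog_odd_part b))
      (key _ _ _ _ (isHomog_odd_part a) (isHomog_odd_part b)))

end AffineModule

/-! ### Weights of the generalized Verma module -/

variable {k n e : ℂ}

theorem vermaMode_hwVector_of_pos {r : ℤ} (hr : 0 < r) (a : Gl) :
    (vermaModule k n e).mode r a (hwVector k n e) = 0 := by
  change vermaMode k n e r a (Submodule.Quotient.mk 1) = 0
  rw [vermaMode_mk, mul_one]
  exact (Submodule.Quotient.mk_eq_zero _).2 (gen_mem_vermaIdeal hr a)

theorem psiPlus_hwVector : (vermaModule k n e).mode 0 psiPlus (hwVector k n e) = 0 := by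
  change vermaMode k n e 0 psiPlus (Submodule.Quotient.mk 1) = 0
  rw [vermaMode_mk, mul_one]
  exact (Submodule.Quotient.mk_eq_zero _).2 (Submodule.subset_span (Or.inr (by simp)))

theorem elN_hwVector :
    (vermaModule k n e).mode 0 elN (hwVector k n e) = (n + 1 / 2) • hwVector k n e := by
  change vermaMode k n e 0 elN (Submodule.Quotient.mk 1) = (n + 1 / 2) • Submodule.Quotient.mk 1
  rw [vermaMode_mk, mul_one, ← Submodule.Quotient.mk_smul, Submodule.Quotient.eq,
    ← Algebra.algebraMap_eq_smul_one]
  exact Submodule.subset_span (Or.inr (by simp))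

theorem elE_hwVector :
    (vermaModule k n e).mode 0 elE (hwVector k n e) = e • hwVector k n e := by
  change vermaMode k n e 0 elE (Submodule.Quotient.mk 1) = e • Submodule.Quotient.mk 1
  rw [vermaMode_mk, mul_one, ← Submodule.Quotient.mk_smul, Submodule.Quotient.eq,
    ← Algebra.algebraMap_eq_smul_one]
  exact Submodule.subset_span (Or.inr (by simp))

theorem parity_hwVector : (vermaModule k n e).parity (hwVector k n e) = hwVector k n e := by
  change vermaParity k n e (Submodule.Quotient.mk 1) = Submodule.Quotient.mk 1
  rw [vermaParity_mk, map_one]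

/-- The vector `ψ⁻_0 v_{n,e}`, which spans the top space of the generalized Verma module together
with `v_{n,e}`. -/
noncomputable def lwVector (k n e : ℂ) : Verma k n e :=
  (vermaModule k n e).mode 0 psiMinus (hwVector k n e)

theorem parity_lwVector : (vermaModule k n e).parity (lwVector k n e) = -lwVector k n e := by
  rw [lwVector, (vermaModule k n e).mode_parity 1 _ isHomog_psiMinus, parity_hwVector, sgn_one,
    neg_one_smul]

theorem psiMinus_lwVector : (vermaModule k n e).mode 0 psiMinus (lwVector k n e) = 0 := by
  have h := LinearMap.congr_fun ((vermaModule k n e).mode_psiMinus_psiMinus 0 0) (hwVector k n e)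
  exact eq_zero_of_eq_neg h

theorem psiPlus_lwVector :
    (vermaModule k n e).mode 0 psiPlus (lwVector k n e) = e • hwVector k n e := by
  have h := LinearMap.congr_fun ((vermaModule k n e).mode_psiPlus_psiMinus 0 0) (hwVector k n e)
  rw [lwVector]
  simpa [psiPlus_hwVector, elE_hwVector] using h

theorem elN_lwVector :
    (vermaModule k n e).mode 0 elN (lwVector k n e) = (n - 1 / 2) • lwVector k n e := by
  have h := LinearMap.congr_fun ((vermaModule k n e).mode_psiMinus_N 0 0) (hwVector k n e)
  simp only [Module.End.mul_apply, LinearMap.add_apply, elN_hwVector, map_smul, add_zero] at h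
  change (n + 1 / 2) • lwVector k n e = (vermaModule k n e).mode 0 elN (lwVector k n e)
    + lwVector k n e at h
  rw [← sub_eq_iff_eq_add] at h
  rw [← h]
  module

theorem elE_lwVector :
    (vermaModule k n e).mode 0 elE (lwVector k n e) = e • lwVector k n e := by
  have h := LinearMap.congr_fun ((vermaModule k n e).mode_psiMinus_E 0 0) (hwVector k n e)
  simp only [Module.End.mul_apply, elE_hwVector, map_smul] at h
  exact h.symm

/-- The bracket `[b_r, ψ⁻_0]` is a mode of index `r`, which annihilates `v_{n,e}` like `b_r`. -/
theorem vermaMode_lwVector_of_pos {r : ℤ} (hr : 0 < r) (a : Gl) :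
    (vermaModule k n e).mode r a (lwVector k n e) = 0 := by
  have key : ∀ (α : ZMod 2) (b : Gl), IsHomog α b →
      (vermaModule k n e).mode r b (lwVector k n e) = 0 := by
    intro α b hb
    have h := (vermaModule k n e).bracket α 1 b psiMinus hb isHomog_psiMinus r 0 (hwVector k n e)
    rw [lwVector]
    simpa [vermaMode_hwVector_of_pos hr, hr.ne', add_zero] using h
  rw [even_add_odd a, map_add, LinearMap.add_apply, key _ _ (isHomog_even_part a),
    key _ _ (isHomog_odd_part a), add_zero]

theorem LZero_hwVector (hk : k ≠ 0) :
    (vermaModule k n e).LZero (hwVector k n e) = Delta k n e • hwVector k n e := by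
  have h : locSum (fun r : ℕ => (vermaModule k n e).sugawaraTerm 0 (r + 1))
      ((vermaModule k n e).sugawaraTerm_locallyFinite 0 1) (hwVector k n e) = 0 := by
    rw [locSum_eq_sum_range (R := 0)]
    · simp
    · intro r _
      simp [AffineModule.sugawaraTerm,
        vermaMode_hwVector_of_pos (show (0 : ℤ) < (r : ℤ) + 1 by omega)]
  have h' := psiPlus_lwVector (k := k) (n := n) (e := e)
  rw [lwVector] at h'
  simp only [AffineModule.LZero, LinearMap.add_apply, LinearMap.smul_apply, LinearMap.sub_apply,
    Module.End.mul_apply, h, h', elE_hwVector, map_smul, elN_hwVector, Delta]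
  match_scalars
  field_simp
  ring

/-- A subspace of the generalized Verma module that contains the highest-weight vector and is
stable under the modes `a_r` with `r ≤ 0` is the whole module: moving positive modes to the right
shows that the smallest such subspace is a submodule. -/
theorem verma_subspace_eq_top {S : Submodule ℂ (Verma k n e)} (hv : hwVector k n e ∈ S)
    (hS : ∀ (d : ℕ) (a : Gl), ∀ x ∈ S, (vermaModule k n e).mode (-d) a x ∈ S) : S = ⊤ := by
  set T : Submodule ℂ (Verma k n e) := sInf {T | hwVector k n e ∈ T ∧
    ∀ (d : ℕ) (a : Gl), ∀ x ∈ T, (vermaModule k n e).mode (-d) a x ∈ T} with hT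
  have hTS : T ≤ S := sInf_le ⟨hv, hS⟩
  have hTv : hwVector k n e ∈ T := by
    rw [hT, Submodule.mem_sInf]
    exact fun _ h => h.1
  have hTneg : ∀ (d : ℕ) (a : Gl), ∀ x ∈ T, (vermaModule k n e).mode (-d) a x ∈ T := by
    intro d a x hx
    rw [hT, Submodule.mem_sInf] at hx ⊢
    exact fun U hU => hU.2 d a x (hx U hU)
  -- the vectors all of whose images under modes lie in `T`
  let P : Submodule ℂ (Verma k n e) :=
    T ⊓ ⨅ (r : ℤ) (a : Gl), T.comap ((vermaModule k n e).mode r a)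
  have memP : ∀ x, x ∈ P ↔ x ∈ T ∧ ∀ r a, (vermaModule k n e).mode r a x ∈ T := by
    intro x
    simp [P, Submodule.mem_iInf]
  have hTP : T ≤ P := by
    refine sInf_le ⟨(memP _).2 ⟨hTv, fun r a => ?_⟩, fun d b x hx => ?_⟩
    · rcases lt_or_ge 0 r with hr | hr
      · rw [vermaMode_hwVector_of_pos hr]
        exact T.zero_mem
      · obtain ⟨d, rfl⟩ : ∃ d : ℕ, r = -d := ⟨r.natAbs, by omega⟩
        exact hTneg d a _ hTv
    · obtain ⟨hxT, hx⟩ := (memP _).1 hx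
      refine (memP _).2 ⟨hTneg d b x hxT, fun r a => ?_⟩
      exact (vermaModule k n e).mode_mode_mem (fun c => hx _ c) (fun b c => hTneg d b _ (hx r c))
        (Or.inr hxT) a b
  refine top_le_iff.mp fun w _ => hTS ?_
  obtain ⟨x, rfl⟩ := Submodule.Quotient.mk_surjective _ w
  induction x using env_induction with
  | hone => exact hTv
  | hsmul c x hx => exact T.smul_mem c (hx trivial)
  | hadd x y hx hy => exact T.add_mem (hx trivial) (hy trivial)
  | hgen r a x hx => exact ((memP _).1 (hTP (hx trivial))).2 r a

/-- The conformal weights of the generalized Verma module lie in `Δ + ℕ`. -/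
theorem iSup_eigenspace_LZero (hk : k ≠ 0) :
    ⨆ j : ℕ, (vermaModule k n e).LZero.eigenspace (Delta k n e + j) = ⊤ := by
  refine verma_subspace_eq_top ?_ fun d a x hx => ?_
  · refine Submodule.mem_iSup_of_mem 0 ?_
    rw [Module.End.mem_eigenspace_iff, LZero_hwVector hk]
    simp
  · refine Submodule.iSup_induction _ (motive := fun x => (vermaModule k n e).mode (-d) a x ∈
      ⨆ j : ℕ, (vermaModule k n e).LZero.eigenspace (Delta k n e + j)) hx ?_ ?_ ?_
    · intro j y hy
      refine Submodule.mem_iSup_of_mem (j + d) ?_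
      rw [Module.End.mem_eigenspace_iff] at hy ⊢
      have h := LinearMap.congr_fun ((vermaModule k n e).LZero_mul_mode hk d a) y
      simp only [Module.End.mul_apply, LinearMap.add_apply, LinearMap.smul_apply, hy,
        map_smul] at h
      rw [h]
      push_cast
      module
    · simp
    · intro y z hy hz
      rw [map_add]
      exact add_mem hy hz

/-- A functional on the lowest conformal weight space annihilates the image of `a_{-d}`,
`d > 0`. -/
theorem contragredient_apply_mode_neg (hk : k ≠ 0) {v₀ : Module.Dual ℂ (Verma k n e)}
    (hv₀ : v₀ ∈ (vermaModule k n e).contragredientWeightSpace (Delta k n e))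
    {r : ℤ} (hr : r < 0) (a : Gl) (x : Verma k n e) :
    v₀ ((vermaModule k n e).mode r a x) = 0 := by
  obtain ⟨d, rfl⟩ : ∃ d : ℕ, r = -d := ⟨r.natAbs, by omega⟩
  have hx : x ∈ ⨆ j : ℕ, (vermaModule k n e).LZero.eigenspace (Delta k n e + j) := by
    rw [iSup_eigenspace_LZero hk]; trivial
  refine Submodule.iSup_induction _ (motive := fun x => v₀ ((vermaModule k n e).mode (-d) a x) = 0)
    hx ?_ (by simp) ?_
  · intro j y hy
    have hne : Delta k n e + (j + d) ≠ Delta k n e := by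
      intro h
      have h0 : ((j + d : ℕ) : ℂ) = 0 := by push_cast; linear_combination h
      have := Nat.cast_eq_zero.mp h0
      omega
    rw [AffineModule.contragredientWeightSpace, Submodule.mem_iInf] at hv₀
    refine (Submodule.mem_dualAnnihilator _).1 (hv₀ ⟨_, hne⟩) _ ?_
    rw [Module.End.mem_eigenspace_iff] at hy
    have h := LinearMap.congr_fun ((vermaModule k n e).LZero_mul_mode hk d a) y
    simp only [Module.End.mul_apply, LinearMap.add_apply, LinearMap.smul_apply, hy,
      map_smul] at h
    have hmem : (vermaModule k n e).mode (-d) a y ∈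
        (vermaModule k n e).LZero.eigenspace (Delta k n e + (j + d)) := by
      rw [Module.End.mem_eigenspace_iff, h]
      module
    exact Module.End.eigenspace_le_maxGenEigenspace hmem
  · intro y z hy hz
    rw [map_add, map_add, hy, hz, add_zero]

/-- On the lowest conformal weight space `ψ⁻_0` only sees the eigenvalue `n + 1/2` of `N_0`: modulo
the images of the negative modes the module is spanned by `v_{n,e}`, of this eigenvalue, and
`ψ⁻_0 v_{n,e}`, which `ψ⁻_0` annihilates. -/
theorem contragredient_apply_psiMinus (hk : k ≠ 0) {v₀ : Module.Dual ℂ (Verma k n e)}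
    (hv₀ : v₀ ∈ (vermaModule k n e).contragredientWeightSpace (Delta k n e))
    (x : Verma k n e) :
    v₀ ((vermaModule k n e).mode 0 psiMinus ((vermaModule k n e).mode 0 elN x)) =
      (n + 1 / 2) * v₀ ((vermaModule k n e).mode 0 psiMinus x) := by
  set V := vermaModule k n e
  have h0 := fun {r : ℤ} (hr : r < 0) a x => contragredient_apply_mode_neg hk hv₀ hr a x
  -- the module is spanned by its top space and the images of the negative modes
  let T : Submodule ℂ (Verma k n e) := Submodule.span ℂ ({hwVector k n e, lwVector k n e} ∪
    {y | ∃ (r : ℤ) (a : Gl) (x : Verma k n e), r < 0 ∧ y = V.mode r a x})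
  have hTv : hwVector k n e ∈ T := Submodule.subset_span (by simp)
  have hTw : lwVector k n e ∈ T := Submodule.subset_span (by simp)
  have hTneg : ∀ {r : ℤ} (hr : r < 0) a x, V.mode r a x ∈ T := fun {r} hr a x =>
    Submodule.subset_span (Or.inr ⟨r, a, x, hr, rfl⟩)
  have hTop : T = ⊤ := by
    refine verma_subspace_eq_top hTv fun d a x hx => ?_
    rcases Nat.eq_zero_or_pos d with rfl | hd
    · have hzero : ∀ u ∈ T, V.mode 0 elN u ∈ T → V.mode 0 elE u ∈ T → V.mode 0 psiPlus u ∈ T →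
          V.mode 0 psiMinus u ∈ T → V.mode 0 a u ∈ T := by
        intro u _ h1 h2 h3 h4
        rw [gl_eq_basis a]
        simp only [map_add, map_smul, LinearMap.add_apply, LinearMap.smul_apply]
        exact T.add_mem (T.add_mem (T.add_mem (T.smul_mem _ h1) (T.smul_mem _ h2))
          (T.smul_mem _ h3)) (T.smul_mem _ h4)
      simp only [Nat.cast_zero, neg_zero]
      induction hx using Submodule.span_induction with
      | mem y hy =>
        rcases hy with (rfl | rfl) | ⟨r, b, y, hr, rfl⟩
        · refine hzero _ hTv ?_ ?_ ?_ ?_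
          · rw [elN_hwVector]; exact T.smul_mem _ hTv
          · rw [elE_hwVector]; exact T.smul_mem _ hTv
          · rw [psiPlus_hwVector]; exact T.zero_mem
          · exact hTw
        · refine hzero _ hTw ?_ ?_ ?_ ?_
          · rw [elN_lwVector]; exact T.smul_mem _ hTw
          · rw [elE_lwVector]; exact T.smul_mem _ hTw
          · rw [psiPlus_lwVector]; exact T.smul_mem _ hTv
          · rw [psiMinus_lwVector]; exact T.zero_mem
        · exact V.mode_mode_mem (fun c => hTneg (by omega) c y) (fun b c => hTneg hr b _)
            (Or.inl (by omega)) a b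
      | zero => simp
      | add y z _ _ hy hz => rw [map_add]; exact T.add_mem hy hz
      | smul c y _ hy => rw [map_smul]; exact T.smul_mem _ hy
    · exact hTneg (by omega) a x
  have hx : x ∈ T := by rw [hTop]; trivial
  induction hx using Submodule.span_induction with
  | mem y hy =>
    rcases hy with (rfl | rfl) | ⟨r, b, y, hr, rfl⟩
    · rw [elN_hwVector, map_smul, map_smul, smul_eq_mul]
    · rw [elN_lwVector, map_smul, psiMinus_lwVector, smul_zero, map_zero, mul_zero]
    · have hz : ∀ b y, v₀ (V.mode 0 psiMinus (V.mode r b y)) = 0 := fun b y =>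
        V.mode_mode_mem (S := LinearMap.ker v₀) (fun c => h0 (by omega) c y) (fun b c => h0 hr b _)
          (Or.inl (by omega)) psiMinus b
      rw [hz, mul_zero]
      exact V.mode_mode_mem (S := LinearMap.ker (v₀ ∘ₗ V.mode 0 psiMinus))
        (fun c => by rw [zero_add]; exact hz c y) (fun b c => hz b _) (Or.inl (by omega)) elN b
  | zero => simp
  | add y z _ _ hy hz => simp only [map_add, hy, hz, mul_add]
  | smul c y _ hy => simp only [map_smul, hy, smul_eq_mul]; ring

/-! ### Commutator and iterate formulas, correlation functions -/

theorem neg_one_pow_mul_choose_neg_one (i : ℕ) : (-1 : ℂ) ^ i * Ring.choose (-1 : ℂ) i = 1 := by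
  rw [Ring.choose_neg, show (1 : ℂ) + i - 1 = (i : ℂ) by ring, Ring.choose_natCast]
  rcases Nat.even_or_odd i with h | h
  · simp [Int.negOnePow_even (i : ℤ) (mod_cast h), h.neg_one_pow]
  · simp [Int.negOnePow_odd (i : ℤ) (mod_cast h), h.neg_one_pow, Units.smul_def]

theorem finite_support_of_eventually {A : Type*} [Zero A] {f : ℕ → A}
    (h : ∀ᶠ i in atTop, f i = 0) : (Function.support f).Finite := by
  rw [← Nat.cofinite_eq_atTop] at h
  exact h

namespace AffineModule

variable {k : ℂ} {W : Type*} [AddCommGroup W] [Module ℂ W] (M : AffineModule k W)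

/-- Vectors annihilated by all positive modes. -/
def IsTop (u : W) : Prop := ∀ r : ℤ, 0 < r → ∀ a, M.mode r a u = 0

/-- On a vector annihilated by the positive modes, `L_{-1}` reduces to its summand `r = 0`. -/
theorem LMinusOne_of_isTop {u : W} (hu : M.IsTop u) : M.LMinusOne u =
    k⁻¹ • (M.mode (-1) elN (M.mode 0 elE u) + M.mode (-1) elE (M.mode 0 elN u)
      - M.mode (-1) psiPlus (M.mode 0 psiMinus u) + M.mode (-1) psiMinus (M.mode 0 psiPlus u))
    + (k ^ 2)⁻¹ • M.mode (-1) elE (M.mode 0 elE u) := by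
  rw [LMinusOne, locSum_eq_sum_range (R := 1)]
  · simp [sugawaraTerm]
  · intro r hr
    simp [sugawaraTerm, hu r (by omega)]

end AffineModule

namespace EvenIntertwiningOperator

variable {k : ℂ} {W₁ W₂ W₃ : Type*} [AddCommGroup W₁] [Module ℂ W₁] [AddCommGroup W₂]
  [Module ℂ W₂] [AddCommGroup W₃] [Module ℂ W₃] {M₁ : AffineModule k W₁} {M₂ : AffineModule k W₂}
  {M₃ : AffineModule k W₃} (Y : EvenIntertwiningOperator M₁ M₂ M₃)
  {α β : ZMod 2} {a : Gl} {u : W₁}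

/-- The commutator formula `a_m 𝒴(u, x) = ± 𝒴(u, x) a_m + x^m 𝒴(a_0 u, x)` for a vector `u`
annihilated by the positive modes: the Jacobi identity with `l = 0`. -/
theorem mode_coeff (ha : IsHomog α a) (hu : u ∈ M₁.part β) (htop : M₁.IsTop u) (m : ℤ) (p : ℂ)
    (j : ℕ) (w : W₂) : M₃.mode m a (Y.coeff p j u w) =
      sgn (α * β) • Y.coeff p j u (M₂.mode m a w) + Y.coeff (p + m) j (M₁.mode 0 a u) w := by
  have h := Y.jacobi α β a u ha hu 0 m p j w
  rw [finsum_eq_single _ 0, finsum_eq_single _ 0] at h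
  · rw [sub_eq_iff_eq_add'.symm]
    simpa using h
  · intro i hi
    rw [htop _ (by omega)]
    simp
  · intro i hi
    rw [Int.cast_zero, Ring.choose_zero_ite, if_neg hi]
    simp

/-- The iterate formula for `𝒴(a_{-1} u, x)`: the Jacobi identity with `l = -1`, `m = 0`. -/
theorem coeff_mode_neg_one (ha : IsHomog α a) (hu : u ∈ M₁.part β) (p : ℂ) (j : ℕ) (w : W₂) :
    Y.coeff p j (M₁.mode (-1) a u) w = ∑ᶠ i : ℕ, (M₃.mode (-1 - i) a (Y.coeff (p + i) j u w) +
      sgn (α * β) • Y.coeff (p - 1 - i) j u (M₂.mode i a w)) := by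
  have h := Y.jacobi α β a u ha hu (-1) 0 p j w
  rw [finsum_eq_single (fun i : ℕ => (Ring.choose ((0 : ℤ) : ℂ) i) • _) 0] at h
  · simp only [Int.cast_zero, Ring.choose_zero_ite, if_true, one_smul, Nat.cast_zero, sub_zero,
      add_zero, Int.cast_neg, Int.cast_one, neg_one_pow_mul_choose_neg_one, zero_add] at h
    rw [← h]
    refine finsum_congr fun i => ?_
    rw [zpow_neg_one, inv_neg, inv_one, neg_one_mul, neg_smul, sub_neg_eq_add, ← sub_eq_add_neg]
  · intro i hi
    rw [Int.cast_zero, Ring.choose_zero_ite, if_neg hi]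
    simp

theorem finite_support_coeff_add (u : W₁) (w : W₂) (p : ℂ) (j : ℕ) :
    (Function.support fun i : ℕ => Y.coeff (p + i) j u w).Finite :=
  finite_support_of_eventually ((Y.lower_truncation u w p).mono fun _ h => h j)

end EvenIntertwiningOperator

section Correlators

variable {k : ℂ} {W₀ W₁ W₂ W₃ W : Type*}
  [AddCommGroup W₀] [Module ℂ W₀] [AddCommGroup W₁] [Module ℂ W₁] [AddCommGroup W₂] [Module ℂ W₂]
  [AddCommGroup W₃] [Module ℂ W₃] [AddCommGroup W] [Module ℂ W]
  {M₀ : AffineModule k W₀} {M₁ : AffineModule k W₁} {M₂ : AffineModule k W₂}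
  {M₃ : AffineModule k W₃} {M : AffineModule k W}
  (Y₁ : EvenIntertwiningOperator M₁ M M₀) (Y₂ : EvenIntertwiningOperator M₂ M₃ M)
  (v₀ : Module.Dual ℂ W₀)

/-- The coefficient of `z₁^{-p₁-1} (log z₁)^{j₁} z₂^{-p₂-1} (log z₂)^{j₂}` in
`⟨v₀, 𝒴₁(u₁, z₁) 𝒴₂(u₂, z₂) u₃⟩`. -/
noncomputable def corr (u₁ : W₁) (u₂ : W₂) (u₃ : W₃) (j₁ j₂ : ℕ) (p₁ p₂ : ℂ) : ℂ :=
  v₀ (Y₁.coeff p₁ j₁ u₁ (Y₂.coeff p₂ j₂ u₂ u₃))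

/-- The coefficients of `F / (z₁ - z₂)`, expanded in nonnegative powers of `z₂ / z₁`, where `H`
gives those of `F`. -/
noncomputable def geomSum (H : ℂ → ℂ → ℂ) (p₁ p₂ : ℂ) : ℂ :=
  ∑ᶠ i : ℕ, H (p₁ - 1 - i) (p₂ + i)

theorem finite_support_corr (u₁ : W₁) (u₂ : W₂) (u₃ : W₃) (j₁ j₂ : ℕ) (p₁ : ℕ → ℂ) (p₂ : ℂ) :
    (Function.support fun i : ℕ => corr Y₁ Y₂ v₀ u₁ u₂ u₃ j₁ j₂ (p₁ i) (p₂ + i)).Finite := by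
  refine finite_support_of_eventually ((Y₂.lower_truncation u₂ u₃ p₂).mono fun i h => ?_)
  rw [corr, h j₂, map_zero, map_zero]

variable {v₀} {α β₁ β₂ : ZMod 2} {a : Gl} {u₁ : W₁} {u₂ : W₂} {u₃ : W₃}

/-- Inserting `a_{-1}` at `z₂`: the negative modes are moved to the left, where `v₀` annihilates
them, and the other ones to the right. -/
theorem corr_mode_neg_one_right (hv₀ : ∀ r : ℤ, r < 0 → ∀ a x, v₀ (M₀.mode r a x) = 0)
    (ha : IsHomog α a) (h₁ : u₁ ∈ M₁.part β₁) (h₂ : u₂ ∈ M₂.part β₂) (t₁ : M₁.IsTop u₁)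
    (t₃ : M₃.IsTop u₃) (j₁ j₂ : ℕ) (p₁ p₂ : ℂ) :
    corr Y₁ Y₂ v₀ u₁ (M₂.mode (-1) a u₂) u₃ j₁ j₂ p₁ p₂ =
      -sgn (α * β₁) * geomSum (corr Y₁ Y₂ v₀ (M₁.mode 0 a u₁) u₂ u₃ j₁ j₂) p₁ p₂
      + sgn (α * β₂) * corr Y₁ Y₂ v₀ u₁ u₂ (M₃.mode 0 a u₃) j₁ j₂ p₁ (p₂ - 1) := by
  have hsgn : sgn (α * β₁) * sgn (α * β₁) = 1 := by
    rw [sgn]; split_ifs <;> norm_num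
  have hfin₁ : (Function.support fun i : ℕ =>
      M.mode (-1 - i) a (Y₂.coeff (p₂ + i) j₂ u₂ u₃)).Finite :=
    (Y₂.finite_support_coeff_add u₂ u₃ p₂ j₂).subset fun i hi h => hi (by simp [h])
  have hzero : ∀ i : ℕ, i ≠ 0 →
      sgn (α * β₂) • Y₂.coeff (p₂ - 1 - i) j₂ u₂ (M₃.mode i a u₃) = 0 := fun i hi => by
    rw [t₃ _ (by omega), map_zero, smul_zero]
  have hfin₂ : (Function.support fun i : ℕ =>
      sgn (α * β₂) • Y₂.coeff (p₂ - 1 - i) j₂ u₂ (M₃.mode i a u₃)).Finite :=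
    (Set.finite_singleton 0).subset fun i hi => by
      by_contra h
      exact hi (hzero i h)
  have hterm : ∀ i : ℕ, v₀ (Y₁.coeff p₁ j₁ u₁ (M.mode (-1 - i) a (Y₂.coeff (p₂ + i) j₂ u₂ u₃))) =
      -sgn (α * β₁) * corr Y₁ Y₂ v₀ (M₁.mode 0 a u₁) u₂ u₃ j₁ j₂ (p₁ - 1 - i) (p₂ + i) := by
    intro i
    have h := congrArg v₀
      (Y₁.mode_coeff ha h₁ t₁ (-1 - i) p₁ j₁ (Y₂.coeff (p₂ + i) j₂ u₂ u₃))
    rw [hv₀ _ (by omega), map_add, map_smul, smul_eq_mul] at h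
    have e : p₁ + ((-1 - i : ℤ) : ℂ) = p₁ - 1 - i := by push_cast; ring
    rw [e] at h
    rw [corr]
    linear_combination (-sgn (α * β₁)) * h - v₀ (Y₁.coeff p₁ j₁ u₁
      (M.mode (-1 - i) a (Y₂.coeff (p₂ + i) j₂ u₂ u₃))) * hsgn
  rw [corr, Y₂.coeff_mode_neg_one ha h₂, finsum_add_distrib hfin₁ hfin₂,
    finsum_eq_single _ 0 hzero, map_add, map_add, map_finsum (Y₁.coeff p₁ j₁ u₁) hfin₁,
    map_finsum v₀ (hfin₁.subset fun i hi h => hi (by simp [h])), finsum_congr hterm,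
    ← mul_finsum, geomSum]
  simp [corr]

/-- Inserting `a_{-1}` at `z₁`: the negative modes are annihilated by `v₀` at once, and the other
ones are moved to the right past `𝒴₂`. -/
theorem corr_mode_neg_one_left (hv₀ : ∀ r : ℤ, r < 0 → ∀ a x, v₀ (M₀.mode r a x) = 0)
    (ha : IsHomog α a) (h₁ : u₁ ∈ M₁.part β₁) (h₂ : u₂ ∈ M₂.part β₂) (t₂ : M₂.IsTop u₂)
    (t₃ : M₃.IsTop u₃) (j₁ j₂ : ℕ) (p₁ p₂ : ℂ) :
    corr Y₁ Y₂ v₀ (M₁.mode (-1) a u₁) u₂ u₃ j₁ j₂ p₁ p₂ =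
      sgn (α * β₁) * (geomSum (corr Y₁ Y₂ v₀ u₁ (M₂.mode 0 a u₂) u₃ j₁ j₂) p₁ p₂
      + sgn (α * β₂) * corr Y₁ Y₂ v₀ u₁ u₂ (M₃.mode 0 a u₃) j₁ j₂ (p₁ - 1) p₂) := by
  set X := Y₂.coeff p₂ j₂ u₂ u₃ with hX
  have hfin₁ : (Function.support fun i : ℕ =>
      M₀.mode (-1 - i) a (Y₁.coeff (p₁ + i) j₁ u₁ X)).Finite :=
    (Y₁.finite_support_coeff_add u₁ X p₁ j₁).subset fun i hi h => hi (by simp [h])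
  have hfin₂ : (Function.support fun i : ℕ =>
      sgn (α * β₁) • Y₁.coeff (p₁ - 1 - i) j₁ u₁ (M.mode i a X)).Finite := by
    obtain ⟨R, hR⟩ := M.smooth X
    refine (Set.finite_lt_nat R.toNat).subset fun i hi => ?_
    by_contra h
    refine hi ?_
    have hi' : R ≤ i := by simp at h; omega
    simp only
    rw [hR _ hi', map_zero, smul_zero]
  have hterm : ∀ i : ℕ, v₀ (sgn (α * β₁) • Y₁.coeff (p₁ - 1 - i) j₁ u₁ (M.mode i a X)) =
      sgn (α * β₁) * (corr Y₁ Y₂ v₀ u₁ (M₂.mode 0 a u₂) u₃ j₁ j₂ (p₁ - 1 - i) (p₂ + i)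
        + sgn (α * β₂) * corr Y₁ Y₂ v₀ u₁ u₂ (M₃.mode i a u₃) j₁ j₂ (p₁ - 1 - i) p₂) := by
    intro i
    rw [hX, Y₂.mode_coeff ha h₂ t₂, map_smul, map_add, map_add, map_smul, map_smul, smul_eq_mul,
      smul_eq_mul, Int.cast_natCast, corr, corr]
    ring
  have hzero : ∀ i : ℕ, i ≠ 0 → sgn (α * β₂) *
      corr Y₁ Y₂ v₀ u₁ u₂ (M₃.mode i a u₃) j₁ j₂ (p₁ - 1 - i) p₂ = 0 := fun i hi => by
    rw [corr, t₃ _ (by omega), map_zero, map_zero, map_zero, mul_zero]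
  have hfin₃ : (Function.support fun i : ℕ => sgn (α * β₂) *
      corr Y₁ Y₂ v₀ u₁ u₂ (M₃.mode i a u₃) j₁ j₂ (p₁ - 1 - i) p₂).Finite :=
    (Set.finite_singleton 0).subset fun i hi => by
      by_contra h
      exact hi (hzero i h)
  have hneg : ∀ i : ℕ, v₀ (M₀.mode (-1 - i) a (Y₁.coeff (p₁ + i) j₁ u₁ X)) = 0 := fun i =>
    hv₀ _ (by omega) _ _
  rw [corr, Y₁.coeff_mode_neg_one ha h₁, ← hX, finsum_add_distrib hfin₁ hfin₂, map_add,
    map_finsum v₀ hfin₁, map_finsum v₀ hfin₂, finsum_congr hneg, finsum_zero, zero_add,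
    finsum_congr hterm, ← mul_finsum,
    finsum_add_distrib (finite_support_corr Y₁ Y₂ v₀ _ _ _ _ _ _ _) hfin₃,
    finsum_eq_single _ 0 hzero, geomSum]
  simp

end Correlators

/-- The vectors `v` and `w` are annihilated by the positive modes and behave under the zero modes
like the basis `v_{n,e}`, `ψ⁻ v_{n,e}` of the Verma module `V_{n,e}` of `gl(1|1)`, with `v` of
parity `β`. -/
structure IsTopPair {k : ℂ} {W : Type*} [AddCommGroup W] [Module ℂ W] (M : AffineModule k W)
    (β : ZMod 2) (n e : ℂ) (v w : W) : Prop where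
  top_v : M.IsTop v
  top_w : M.IsTop w
  part_v : v ∈ M.part β
  part_w : w ∈ M.part (β + 1)
  N_v : M.mode 0 elN v = (n + 1 / 2) • v
  N_w : M.mode 0 elN w = (n - 1 / 2) • w
  E_v : M.mode 0 elE v = e • v
  E_w : M.mode 0 elE w = e • w
  psiPlus_v : M.mode 0 psiPlus v = 0
  psiPlus_w : M.mode 0 psiPlus w = e • v
  psiMinus_v : M.mode 0 psiMinus v = w
  psiMinus_w : M.mode 0 psiMinus w = 0

theorem isTopPair_verma (k n e : ℂ) :
    IsTopPair (vermaModule k n e) 0 n e (hwVector k n e) (lwVector k n e) where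
  top_v _ hr a := vermaMode_hwVector_of_pos hr a
  top_w _ hr a := vermaMode_lwVector_of_pos hr a
  part_v := by simp [AffineModule.part, sgn_zero, parity_hwVector]
  part_w := by simp [AffineModule.part, sgn_one, parity_lwVector]
  N_v := elN_hwVector
  N_w := elN_lwVector
  E_v := elE_hwVector
  E_w := elE_lwVector
  psiPlus_v := psiPlus_hwVector
  psiPlus_w := psiPlus_lwVector
  psiMinus_v := rfl
  psiMinus_w := psiMinus_lwVector

theorem isTopPair_verma_parityReverse (k n e : ℂ) :
    IsTopPair (vermaModule k n e).parityReverse 1 n e (hwVector k n e) (lwVector k n e) where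
  top_v _ hr a := vermaMode_hwVector_of_pos hr a
  top_w _ hr a := vermaMode_lwVector_of_pos hr a
  part_v := by
    simp [AffineModule.part, AffineModule.parityReverse, sgn_one, parity_hwVector]
  part_w := by
    have : (1 + 1 : ZMod 2) = 0 := rfl
    simp [AffineModule.part, AffineModule.parityReverse, this, sgn_zero, parity_lwVector]
  N_v := elN_hwVector
  N_w := elN_lwVector
  E_v := elE_hwVector
  E_w := elE_lwVector
  psiPlus_v := psiPlus_hwVector
  psiPlus_w := psiPlus_lwVector
  psiMinus_v := rfl
  psiMinus_w := psiMinus_lwVector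

section Correlators

variable {k : ℂ} {W₀ W₁ W₂ W₃ W : Type*}
  [AddCommGroup W₀] [Module ℂ W₀] [AddCommGroup W₁] [Module ℂ W₁] [AddCommGroup W₂] [Module ℂ W₂]
  [AddCommGroup W₃] [Module ℂ W₃] [AddCommGroup W] [Module ℂ W]
  {M₀ : AffineModule k W₀} {M₁ : AffineModule k W₁} {M₂ : AffineModule k W₂}
  {M₃ : AffineModule k W₃} {M : AffineModule k W}
  (Y₁ : EvenIntertwiningOperator M₁ M M₀) (Y₂ : EvenIntertwiningOperator M₂ M₃ M)
  (v₀ : Module.Dual ℂ W₀)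

/-! ### The Knizhnik–Zamolodchikov equations -/

theorem corr_smul₁ (c : ℂ) (u₁ : W₁) (u₂ : W₂) (u₃ : W₃) (j₁ j₂ : ℕ) :
    corr Y₁ Y₂ v₀ (c • u₁) u₂ u₃ j₁ j₂ =
      fun p₁ p₂ => c * corr Y₁ Y₂ v₀ u₁ u₂ u₃ j₁ j₂ p₁ p₂ := by
  ext; simp [corr]

theorem corr_smul₂ (c : ℂ) (u₁ : W₁) (u₂ : W₂) (u₃ : W₃) (j₁ j₂ : ℕ) :
    corr Y₁ Y₂ v₀ u₁ (c • u₂) u₃ j₁ j₂ =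
      fun p₁ p₂ => c * corr Y₁ Y₂ v₀ u₁ u₂ u₃ j₁ j₂ p₁ p₂ := by
  ext; simp [corr]

theorem corr_smul₃ (c : ℂ) (u₁ : W₁) (u₂ : W₂) (u₃ : W₃) (j₁ j₂ : ℕ) :
    corr Y₁ Y₂ v₀ u₁ u₂ (c • u₃) j₁ j₂ =
      fun p₁ p₂ => c * corr Y₁ Y₂ v₀ u₁ u₂ u₃ j₁ j₂ p₁ p₂ := by
  ext; simp [corr]

theorem corr_zero₁ (u₂ : W₂) (u₃ : W₃) (j₁ j₂ : ℕ) : corr Y₁ Y₂ v₀ 0 u₂ u₃ j₁ j₂ = 0 := by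
  ext; simp [corr]

theorem corr_zero₂ (u₁ : W₁) (u₃ : W₃) (j₁ j₂ : ℕ) : corr Y₁ Y₂ v₀ u₁ 0 u₃ j₁ j₂ = 0 := by
  ext; simp [corr]

theorem corr_zero₃ (u₁ : W₁) (u₂ : W₂) (j₁ j₂ : ℕ) : corr Y₁ Y₂ v₀ u₁ u₂ 0 j₁ j₂ = 0 := by
  ext; simp [corr]

theorem geomSum_mul (c : ℂ) (H : ℂ → ℂ → ℂ) :
    geomSum (fun p₁ p₂ => c * H p₁ p₂) = fun p₁ p₂ => c * geomSum H p₁ p₂ := by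
  ext p₁ p₂
  exact (mul_finsum _ _).symm

theorem geomSum_zero : geomSum 0 = 0 := by
  ext; simp [geomSum]

/-- The `L_{-1}`-derivative property in `z₂`, with `L_{-1}` written by means of
modes `a_{-1} b_0`. -/
theorem corr_derivative_right (u₁ : W₁) {u₂ : W₂} (u₃ : W₃) (ht : M₂.IsTop u₂) (j₁ j₂ : ℕ)
    (p₁ p₂ : ℂ) :
    -p₂ * corr Y₁ Y₂ v₀ u₁ u₂ u₃ j₁ j₂ p₁ (p₂ - 1)
        + (j₂ + 1) * corr Y₁ Y₂ v₀ u₁ u₂ u₃ j₁ (j₂ + 1) p₁ (p₂ - 1) =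
      k⁻¹ * (corr Y₁ Y₂ v₀ u₁ (M₂.mode (-1) elN (M₂.mode 0 elE u₂)) u₃ j₁ j₂ p₁ p₂
        + corr Y₁ Y₂ v₀ u₁ (M₂.mode (-1) elE (M₂.mode 0 elN u₂)) u₃ j₁ j₂ p₁ p₂
        - corr Y₁ Y₂ v₀ u₁ (M₂.mode (-1) psiPlus (M₂.mode 0 psiMinus u₂)) u₃ j₁ j₂ p₁ p₂
        + corr Y₁ Y₂ v₀ u₁ (M₂.mode (-1) psiMinus (M₂.mode 0 psiPlus u₂)) u₃ j₁ j₂ p₁ p₂)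
      + (k ^ 2)⁻¹ *
        corr Y₁ Y₂ v₀ u₁ (M₂.mode (-1) elE (M₂.mode 0 elE u₂)) u₃ j₁ j₂ p₁ p₂ := by
  have h := congrArg (fun X => v₀ (Y₁.coeff p₁ j₁ u₁ X)) (Y₂.derivative u₂ u₃ p₂ j₂)
  rw [M₂.LMinusOne_of_isTop ht] at h
  simp only [map_add, map_sub, map_smul, LinearMap.add_apply, LinearMap.sub_apply,
    LinearMap.smul_apply, smul_eq_mul] at h
  exact h.symm

/-- The `L_{-1}`-derivative property in `z₁`, with `L_{-1}` written by means of
modes `a_{-1} b_0`. -/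
theorem corr_derivative_left {u₁ : W₁} (u₂ : W₂) (u₃ : W₃) (ht : M₁.IsTop u₁) (j₁ j₂ : ℕ)
    (p₁ p₂ : ℂ) :
    -p₁ * corr Y₁ Y₂ v₀ u₁ u₂ u₃ j₁ j₂ (p₁ - 1) p₂
        + (j₁ + 1) * corr Y₁ Y₂ v₀ u₁ u₂ u₃ (j₁ + 1) j₂ (p₁ - 1) p₂ =
      k⁻¹ * (corr Y₁ Y₂ v₀ (M₁.mode (-1) elN (M₁.mode 0 elE u₁)) u₂ u₃ j₁ j₂ p₁ p₂
        + corr Y₁ Y₂ v₀ (M₁.mode (-1) elE (M₁.mode 0 elN u₁)) u₂ u₃ j₁ j₂ p₁ p₂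
        - corr Y₁ Y₂ v₀ (M₁.mode (-1) psiPlus (M₁.mode 0 psiMinus u₁)) u₂ u₃ j₁ j₂ p₁ p₂
        + corr Y₁ Y₂ v₀ (M₁.mode (-1) psiMinus (M₁.mode 0 psiPlus u₁)) u₂ u₃ j₁ j₂ p₁ p₂)
      + (k ^ 2)⁻¹ *
        corr Y₁ Y₂ v₀ (M₁.mode (-1) elE (M₁.mode 0 elE u₁)) u₂ u₃ j₁ j₂ p₁ p₂ := by
  have h := congrArg v₀ (Y₁.derivative u₁ (Y₂.coeff p₂ j₂ u₂ u₃) p₁ j₁)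
  rw [M₁.LMinusOne_of_isTop ht] at h
  simp only [map_add, map_sub, map_smul, LinearMap.add_apply, LinearMap.sub_apply,
    LinearMap.smul_apply, smul_eq_mul] at h
  exact h.symm

variable {v₀} {n e : ℂ} {v₁ w₁ : W₁} {v₂ w₂ : W₂} {v₃ w₃ : W₃}

/-- The Ward identity for `ψ⁻_0`. The vector `𝒴₁(v₁, z₁) 𝒴₂(v₂, z₂) v₃` has the `N_0`-eigenvalue
`n + 3/2` and not `n + 1/2`, so that `v₀ ∘ ψ⁻_0` annihilates it. -/
theorem corr_ward (h₁ : IsTopPair M₁ 0 n e v₁ w₁)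
    (h₂ : IsTopPair M₂ 1 (-n) (-e) v₂ w₂) (h₃ : IsTopPair M₃ 0 n e v₃ w₃)
    (hψ : ∀ x, v₀ (M₀.mode 0 psiMinus (M₀.mode 0 elN x)) =
      (n + 1 / 2) * v₀ (M₀.mode 0 psiMinus x)) (j₁ j₂ : ℕ) (p₁ p₂ : ℂ) :
    corr Y₁ Y₂ v₀ w₁ v₂ v₃ j₁ j₂ p₁ p₂ =
      corr Y₁ Y₂ v₀ v₁ v₂ w₃ j₁ j₂ p₁ p₂ - corr Y₁ Y₂ v₀ v₁ w₂ v₃ j₁ j₂ p₁ p₂ := by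
  have hN : M₀.mode 0 elN (Y₁.coeff p₁ j₁ v₁ (Y₂.coeff p₂ j₂ v₂ v₃)) =
      (n + 3 / 2) • Y₁.coeff p₁ j₁ v₁ (Y₂.coeff p₂ j₂ v₂ v₃) := by
    rw [Y₁.mode_coeff isHomog_elN h₁.part_v h₁.top_v, Y₂.mode_coeff isHomog_elN h₂.part_v h₂.top_v,
      h₁.N_v, h₂.N_v, h₃.N_v]
    simp only [zero_mul, sgn_zero, map_add, map_smul, LinearMap.smul_apply, Int.cast_zero,
      add_zero]
    module
  have h0 := hψ (Y₁.coeff p₁ j₁ v₁ (Y₂.coeff p₂ j₂ v₂ v₃))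
  rw [hN, map_smul, map_smul, smul_eq_mul] at h0
  have h0' : v₀ (M₀.mode 0 psiMinus (Y₁.coeff p₁ j₁ v₁ (Y₂.coeff p₂ j₂ v₂ v₃))) = 0 := by
    linear_combination h0
  rw [Y₁.mode_coeff isHomog_psiMinus h₁.part_v h₁.top_v,
    Y₂.mode_coeff isHomog_psiMinus h₂.part_v h₂.top_v, h₁.psiMinus_v, h₂.psiMinus_v,
    h₃.psiMinus_v] at h0'
  simp only [mul_zero, mul_one, sgn_zero, sgn_one, map_add, map_smul, Int.cast_zero,
    add_zero, smul_eq_mul] at h0'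
  simp only [corr]
  linear_combination h0'

/-- The Knizhnik–Zamolodchikov equation for `∂/∂z₂` of
`⟨v₀, 𝒴₁(v₁, z₁) 𝒴₂(v₂, z₂) w₃⟩`, as an identity of coefficients. -/
theorem corr_kz_right_x (hk : k ≠ 0) (h₁ : IsTopPair M₁ 0 n e v₁ w₁)
    (h₂ : IsTopPair M₂ 1 (-n) (-e) v₂ w₂) (h₃ : IsTopPair M₃ 0 n e v₃ w₃)
    (hv₀ : ∀ r : ℤ, r < 0 → ∀ a x, v₀ (M₀.mode r a x) = 0) (j₁ j₂ : ℕ) (p₁ p₂ : ℂ) :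
    -p₂ * corr Y₁ Y₂ v₀ v₁ v₂ w₃ j₁ j₂ p₁ (p₂ - 1)
        + (j₂ + 1) * corr Y₁ Y₂ v₀ v₁ v₂ w₃ j₁ (j₂ + 1) p₁ (p₂ - 1) =
      2 * Delta k n e * geomSum (corr Y₁ Y₂ v₀ v₁ v₂ w₃ j₁ j₂) p₁ p₂
        + (e / k - 2 * Delta k n e) * corr Y₁ Y₂ v₀ v₁ v₂ w₃ j₁ j₂ p₁ (p₂ - 1)
        - e / k * corr Y₁ Y₂ v₀ v₁ w₂ v₃ j₁ j₂ p₁ (p₂ - 1) := by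
  have hadd : (1 + 1 : ZMod 2) = 0 := rfl
  have hd := corr_derivative_right Y₁ Y₂ v₀ v₁ w₃ h₂.top_v j₁ j₂ p₁ p₂
  simp only [h₁.N_v, h₁.E_v, h₁.psiPlus_v, h₂.N_v, h₂.E_v,
    h₂.psiMinus_v, h₂.psiPlus_v, h₃.N_w, h₃.E_w,
    h₃.psiPlus_w, map_smul, map_zero, corr_smul₁, corr_smul₂, corr_zero₁, corr_zero₂,
    corr_mode_neg_one_right Y₁ Y₂ hv₀ isHomog_elN h₁.part_v h₂.part_v h₁.top_v h₃.top_w,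
    corr_mode_neg_one_right Y₁ Y₂ hv₀ isHomog_elE h₁.part_v h₂.part_v h₁.top_v h₃.top_w,
    corr_mode_neg_one_right Y₁ Y₂ hv₀ isHomog_psiPlus h₁.part_v h₂.part_w h₁.top_v h₃.top_w,
    corr_smul₃, geomSum_mul, geomSum_zero, Pi.zero_apply, mul_zero, mul_one, one_mul,
    zero_add, hadd, sgn_zero] at hd
  rw [hd, Delta]
  field_simp
  ring

/-- The Knizhnik–Zamolodchikov equation for `∂/∂z₂` of
`⟨v₀, 𝒴₁(v₁, z₁) 𝒴₂(w₂, z₂) v₃⟩`, as an identity of coefficients. -/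
theorem corr_kz_right_y (hk : k ≠ 0) (h₁ : IsTopPair M₁ 0 n e v₁ w₁)
    (h₂ : IsTopPair M₂ 1 (-n) (-e) v₂ w₂) (h₃ : IsTopPair M₃ 0 n e v₃ w₃)
    (hv₀ : ∀ r : ℤ, r < 0 → ∀ a x, v₀ (M₀.mode r a x) = 0) (j₁ j₂ : ℕ) (p₁ p₂ : ℂ) :
    -p₂ * corr Y₁ Y₂ v₀ v₁ w₂ v₃ j₁ j₂ p₁ (p₂ - 1)
        + (j₂ + 1) * corr Y₁ Y₂ v₀ v₁ w₂ v₃ j₁ (j₂ + 1) p₁ (p₂ - 1) =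
      (2 * Delta k n e + e / k) * geomSum (corr Y₁ Y₂ v₀ v₁ w₂ v₃ j₁ j₂) p₁ p₂
        - (2 * Delta k n e + e / k) * corr Y₁ Y₂ v₀ v₁ w₂ v₃ j₁ j₂ p₁ (p₂ - 1)
        + e / k * geomSum (corr Y₁ Y₂ v₀ w₁ v₂ v₃ j₁ j₂) p₁ p₂
        + e / k * corr Y₁ Y₂ v₀ v₁ v₂ w₃ j₁ j₂ p₁ (p₂ - 1) := by
  have hadd : (1 + 1 : ZMod 2) = 0 := rfl
  have hd := corr_derivative_right Y₁ Y₂ v₀ v₁ v₃ h₂.top_w j₁ j₂ p₁ p₂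
  simp only [h₁.N_v, h₁.E_v, h₁.psiMinus_v, h₂.N_w,
    h₂.E_w, h₂.psiMinus_w, h₂.psiPlus_w, h₃.N_v, h₃.E_v,
    h₃.psiMinus_v, map_smul, map_zero, corr_smul₁, corr_smul₂, corr_zero₂,
    corr_mode_neg_one_right Y₁ Y₂ hv₀ isHomog_elN h₁.part_v h₂.part_w h₁.top_v h₃.top_v,
    corr_mode_neg_one_right Y₁ Y₂ hv₀ isHomog_elE h₁.part_v h₂.part_w h₁.top_v h₃.top_v,
    corr_mode_neg_one_right Y₁ Y₂ hv₀ isHomog_psiMinus h₁.part_v h₂.part_v h₁.top_v h₃.top_v,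
    corr_smul₃, geomSum_mul, Pi.zero_apply, mul_zero, mul_one, one_mul,
    hadd, sgn_zero, sgn_one] at hd
  rw [hd, Delta]
  field_simp
  ring

/-- The Knizhnik–Zamolodchikov equation for `∂/∂z₁` of
`⟨v₀, 𝒴₁(v₁, z₁) 𝒴₂(v₂, z₂) w₃⟩`, as an identity of coefficients. -/
theorem corr_kz_left_x (hk : k ≠ 0) (h₁ : IsTopPair M₁ 0 n e v₁ w₁)
    (h₂ : IsTopPair M₂ 1 (-n) (-e) v₂ w₂) (h₃ : IsTopPair M₃ 0 n e v₃ w₃)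
    (hv₀ : ∀ r : ℤ, r < 0 → ∀ a x, v₀ (M₀.mode r a x) = 0) (j₁ j₂ : ℕ) (p₁ p₂ : ℂ) :
    -p₁ * corr Y₁ Y₂ v₀ v₁ v₂ w₃ j₁ j₂ (p₁ - 1) p₂
        + (j₁ + 1) * corr Y₁ Y₂ v₀ v₁ v₂ w₃ (j₁ + 1) j₂ (p₁ - 1) p₂ =
      -(2 * Delta k n e) * geomSum (corr Y₁ Y₂ v₀ v₁ v₂ w₃ j₁ j₂) p₁ p₂
        + 2 * Delta k n e * corr Y₁ Y₂ v₀ v₁ v₂ w₃ j₁ j₂ (p₁ - 1) p₂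
        - e / k * corr Y₁ Y₂ v₀ w₁ v₂ v₃ j₁ j₂ (p₁ - 1) p₂ := by
  have hadd : (1 + 1 : ZMod 2) = 0 := rfl
  have hd := corr_derivative_left Y₁ Y₂ v₀ v₂ w₃ h₁.top_v j₁ j₂ p₁ p₂
  simp only [h₁.N_v, h₁.E_v, h₁.psiMinus_v, h₁.psiPlus_v, h₂.N_v, h₂.E_v,
    h₂.psiPlus_v, h₃.N_w, h₃.E_w,
    h₃.psiPlus_w, map_smul, map_zero, corr_smul₁, corr_smul₂, corr_zero₁, corr_zero₂,
    corr_mode_neg_one_left Y₁ Y₂ hv₀ isHomog_elN h₁.part_v h₂.part_v h₂.top_v h₃.top_w,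
    corr_mode_neg_one_left Y₁ Y₂ hv₀ isHomog_elE h₁.part_v h₂.part_v h₂.top_v h₃.top_w,
    corr_mode_neg_one_left Y₁ Y₂ hv₀ isHomog_psiPlus h₁.part_w h₂.part_v h₂.top_v h₃.top_w,
    corr_smul₃, geomSum_mul, geomSum_zero, Pi.zero_apply, mul_zero, mul_one, one_mul,
    zero_add, sgn_zero, sgn_one] at hd
  rw [hd, Delta]
  field_simp
  ring

/-- The Knizhnik–Zamolodchikov equation for `∂/∂z₁` of
`⟨v₀, 𝒴₁(v₁, z₁) 𝒴₂(w₂, z₂) v₃⟩`, as an identity of coefficients. -/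
theorem corr_kz_left_y (hk : k ≠ 0) (h₁ : IsTopPair M₁ 0 n e v₁ w₁)
    (h₂ : IsTopPair M₂ 1 (-n) (-e) v₂ w₂) (h₃ : IsTopPair M₃ 0 n e v₃ w₃)
    (hv₀ : ∀ r : ℤ, r < 0 → ∀ a x, v₀ (M₀.mode r a x) = 0) (j₁ j₂ : ℕ) (p₁ p₂ : ℂ) :
    -p₁ * corr Y₁ Y₂ v₀ v₁ w₂ v₃ j₁ j₂ (p₁ - 1) p₂
        + (j₁ + 1) * corr Y₁ Y₂ v₀ v₁ w₂ v₃ (j₁ + 1) j₂ (p₁ - 1) p₂ =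
      -(2 * Delta k n e + e / k) * geomSum (corr Y₁ Y₂ v₀ v₁ w₂ v₃ j₁ j₂) p₁ p₂
        + (2 * Delta k n e + e / k) * corr Y₁ Y₂ v₀ v₁ w₂ v₃ j₁ j₂ (p₁ - 1) p₂
        - e / k * geomSum (corr Y₁ Y₂ v₀ w₁ v₂ v₃ j₁ j₂) p₁ p₂ := by
  have hadd : (1 + 1 : ZMod 2) = 0 := rfl
  have hd := corr_derivative_left Y₁ Y₂ v₀ w₂ v₃ h₁.top_v j₁ j₂ p₁ p₂
  simp only [h₁.N_v, h₁.E_v, h₁.psiMinus_v, h₁.psiPlus_v, h₂.N_w,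
    h₂.E_w, h₂.psiPlus_w, h₃.N_v, h₃.E_v,
    h₃.psiPlus_v, map_smul, map_zero, corr_smul₁, corr_smul₂, corr_zero₁,
    corr_mode_neg_one_left Y₁ Y₂ hv₀ isHomog_elN h₁.part_v h₂.part_w h₂.top_w h₃.top_v,
    corr_mode_neg_one_left Y₁ Y₂ hv₀ isHomog_elE h₁.part_v h₂.part_w h₂.top_w h₃.top_v,
    corr_mode_neg_one_left Y₁ Y₂ hv₀ isHomog_psiPlus h₁.part_w h₂.part_w h₂.top_w h₃.top_v,
    corr_smul₃, corr_zero₃, geomSum_mul, Pi.zero_apply, mul_zero, mul_one, one_mul,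
    zero_add, hadd, sgn_zero, sgn_one] at hd
  rw [hd, Delta]
  field_simp
  ring

end Correlators

/-! ### Homogeneity of the correlation functions -/

theorem finsum_nat_eq_add_finsum_succ {A : Type*} [AddCommMonoid A] {f : ℕ → A}
    (hf : (Function.support f).Finite) : ∑ᶠ i, f i = f 0 + ∑ᶠ i, f (i + 1) := by
  obtain ⟨N, hN⟩ := hf.bddAbove
  have h0 : ∀ i, N < i → f i = 0 := fun i hi => by
    by_contra h
    exact absurd (hN h) (by omega)
  rw [finsum_eq_sum_of_support_subset (s := Finset.range (N + 1)),
    finsum_eq_sum_of_support_subset (f := fun i => f (i + 1)) (s := Finset.range N),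
    Finset.sum_range_succ', add_comm]
  · intro i hi
    by_contra h
    exact hi (h0 _ (by simp at h; omega))
  · intro i hi
    by_contra h
    exact hi (h0 _ (by simp at h; omega))

/-- A finitely supported solution of `(a + ∂₁ + ∂₂) f = 0` with `a ≠ 0` vanishes, since the
operator `∂₁ + ∂₂` on polynomials is locally nilpotent. -/
theorem eq_zero_of_nilpotent_shift {f : ℕ → ℕ → ℂ} {a : ℂ} (ha : a ≠ 0) {J : ℕ}
    (hJ : ∀ i j, J ≤ i + j → f i j = 0)
    (h : ∀ i j : ℕ, a * f i j + (i + 1) * f (i + 1) j + (j + 1) * f i (j + 1) = 0) (i j : ℕ) :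
    f i j = 0 := by
  have key : ∀ m i j, J ≤ i + j + m → f i j = 0 := by
    intro m
    induction m with
    | zero => exact hJ
    | succ m ih =>
      intro i j hij
      have h0 := h i j
      rw [ih (i + 1) j (by omega), ih i (j + 1) (by omega), mul_zero, mul_zero, add_zero,
        add_zero] at h0
      exact (mul_eq_zero.mp h0).resolve_left ha
  exact key J i j (by omega)

section Correlators

variable {k : ℂ} {W₀ W₁ W₂ W₃ W : Type*}
  [AddCommGroup W₀] [Module ℂ W₀] [AddCommGroup W₁] [Module ℂ W₁] [AddCommGroup W₂] [Module ℂ W₂]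
  [AddCommGroup W₃] [Module ℂ W₃] [AddCommGroup W] [Module ℂ W]
  {M₀ : AffineModule k W₀} {M₁ : AffineModule k W₁} {M₂ : AffineModule k W₂}
  {M₃ : AffineModule k W₃} {M : AffineModule k W}
  (Y₁ : EvenIntertwiningOperator M₁ M M₀) (Y₂ : EvenIntertwiningOperator M₂ M₃ M)
  (v₀ : Module.Dual ℂ W₀)

/-- The identity `z₁ / (z₁ - z₂) = 1 + z₂ / (z₁ - z₂)` for the expanded quotients. -/
theorem geomSum_corr_add_one (u₁ : W₁) (u₂ : W₂) (u₃ : W₃) (j₁ j₂ : ℕ) (p₁ p₂ : ℂ) :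
    geomSum (corr Y₁ Y₂ v₀ u₁ u₂ u₃ j₁ j₂) (p₁ + 1) p₂ =
      corr Y₁ Y₂ v₀ u₁ u₂ u₃ j₁ j₂ p₁ p₂ +
        geomSum (corr Y₁ Y₂ v₀ u₁ u₂ u₃ j₁ j₂) p₁ (p₂ + 1) := by
  rw [geomSum, finsum_nat_eq_add_finsum_succ (finite_support_corr Y₁ Y₂ v₀ u₁ u₂ u₃ j₁ j₂ _ p₂),
    geomSum]
  congr 1
  · simp
  · refine finsum_congr fun i => ?_
    congr 1 <;> push_cast <;> ring

theorem corr_log_finite (u₁ : W₁) (u₂ : W₂) (u₃ : W₃) (p₁ p₂ : ℂ) :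
    ∃ J : ℕ, ∀ i j, J ≤ i + j → corr Y₁ Y₂ v₀ u₁ u₂ u₃ i j p₁ p₂ = 0 := by
  obtain ⟨J₂, hJ₂⟩ := eventually_atTop.mp (Y₂.log_finite u₂ u₃ p₂)
  have h : ∀ᶠ i in atTop, ∀ j ∈ Finset.range J₂, Y₁.coeff p₁ i u₁ (Y₂.coeff p₂ j u₂ u₃) = 0 :=
    (Finset.range J₂).eventually_all.mpr fun j _ => Y₁.log_finite u₁ _ p₁
  obtain ⟨J₁, hJ₁⟩ := eventually_atTop.mp h
  refine ⟨J₁ + J₂, fun i j hij => ?_⟩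
  rcases lt_or_ge j J₂ with hj | hj
  · rw [corr, hJ₁ i (by omega) j (Finset.mem_range.mpr hj), map_zero]
  · rw [corr, hJ₂ j hj, map_zero, map_zero]

variable {v₀} {n e : ℂ} {v₁ w₁ : W₁} {v₂ w₂ : W₂} {v₃ w₃ : W₃}

/-- The correlation functions `⟨v₀, 𝒴₁(v₁, z₁) 𝒴₂(v₂, z₂) w₃⟩` and
`⟨v₀, 𝒴₁(v₁, z₁) 𝒴₂(w₂, z₂) v₃⟩` are homogeneous of degree `-2Δ`: the sum of the equations for
`z₁ ∂₁` and `z₂ ∂₂` has constant coefficients. -/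
theorem corr_eq_zero_of_degree (hk : k ≠ 0) (h₁ : IsTopPair M₁ 0 n e v₁ w₁)
    (h₂ : IsTopPair M₂ 1 (-n) (-e) v₂ w₂) (h₃ : IsTopPair M₃ 0 n e v₃ w₃)
    (hv₀ : ∀ r : ℤ, r < 0 → ∀ a x, v₀ (M₀.mode r a x) = 0)
    (hψ : ∀ x, v₀ (M₀.mode 0 psiMinus (M₀.mode 0 elN x)) =
      (n + 1 / 2) * v₀ (M₀.mode 0 psiMinus x)) (j₁ j₂ : ℕ) {p₁ p₂ : ℂ}
    (hp : p₁ + p₂ + 2 ≠ 2 * Delta k n e) :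
    corr Y₁ Y₂ v₀ v₁ v₂ w₃ j₁ j₂ p₁ p₂ = 0 ∧ corr Y₁ Y₂ v₀ v₁ w₂ v₃ j₁ j₂ p₁ p₂ = 0 := by
  have hne : 2 * Delta k n e - (p₁ + p₂ + 2) ≠ 0 := sub_ne_zero.mpr hp.symm
  constructor
  · obtain ⟨J, hJ⟩ := corr_log_finite Y₁ Y₂ v₀ v₁ v₂ w₃ p₁ p₂
    refine eq_zero_of_nilpotent_shift hne hJ (fun i j => ?_) j₁ j₂
    have hr := corr_kz_right_x Y₁ Y₂ hk h₁ h₂ h₃ hv₀ i j p₁ (p₂ + 1)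
    have hl := corr_kz_left_x Y₁ Y₂ hk h₁ h₂ h₃ hv₀ i j (p₁ + 1) p₂
    rw [geomSum_corr_add_one] at hl
    rw [add_sub_cancel_right] at hl hr
    rw [corr_ward Y₁ Y₂ h₁ h₂ h₃ hψ] at hl
    linear_combination hl + hr
  · obtain ⟨J, hJ⟩ := corr_log_finite Y₁ Y₂ v₀ v₁ w₂ v₃ p₁ p₂
    refine eq_zero_of_nilpotent_shift hne hJ (fun i j => ?_) j₁ j₂
    have hr := corr_kz_right_y Y₁ Y₂ hk h₁ h₂ h₃ hv₀ i j p₁ (p₂ + 1)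
    have hl := corr_kz_left_y Y₁ Y₂ hk h₁ h₂ h₃ hv₀ i j (p₁ + 1) p₂
    rw [geomSum_corr_add_one, geomSum_corr_add_one] at hl
    rw [add_sub_cancel_right] at hl hr
    rw [corr_ward Y₁ Y₂ h₁ h₂ h₃ hψ] at hl
    linear_combination hl + hr

end Correlators

/-! ### The formal system at `z = 0` -/

/-- Two formal series `∑ X_{s,j} z^s (log z)^j` and `∑ Y_{s,j} z^s (log z)^j` that solve the system
`z X' = (c - a) X - c Y + a z (1 - z)⁻¹ X`,
`z Y' = c X - (a + c) Y + z (1 - z)⁻¹ (a Y + c X)`. -/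
structure IsFormalSolution (a c : ℂ) (X Y : ℂ → ℕ → ℂ) : Prop where
  eq_X : ∀ s (j : ℕ), s * X s j + (j + 1) * X s (j + 1) =
    a * ∑ᶠ i : ℕ, X (s - 1 - i) j + (c - a) * X s j - c * Y s j
  eq_Y : ∀ s (j : ℕ), s * Y s j + (j + 1) * Y s (j + 1) =
    a * ∑ᶠ i : ℕ, Y (s - 1 - i) j + c * ∑ᶠ i : ℕ, X (s - 1 - i) j + c * X s j - (a + c) * Y s j
  truncation : ∀ s, ∀ᶠ i : ℕ in atTop, ∀ j, X (s - i) j = 0 ∧ Y (s - i) j = 0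
  log_finite : ∀ s, ∀ᶠ j in atTop, X s j = 0 ∧ Y s j = 0

namespace IsFormalSolution

variable {a c : ℂ} {X Y : ℂ → ℕ → ℂ}

/-- Away from the exponent `-a` the coefficients of the lower powers determine the next ones. -/
theorem eq_zero_of_lower (h : IsFormalSolution a c X Y) {s : ℂ} (hs : s + a ≠ 0) (J : ℕ)
    (hX : ∀ j, J ≤ j → ∀ i : ℕ, X (s - 1 - i) j = 0 ∧ Y (s - 1 - i) j = 0) (j : ℕ) (hj : J ≤ j) :
    X s j = 0 ∧ Y s j = 0 := by
  obtain ⟨N, hN⟩ := eventually_atTop.mp (h.log_finite s)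
  have key : ∀ m j, J ≤ j → N ≤ j + m → X s j = 0 ∧ Y s j = 0 := by
    intro m
    induction m with
    | zero => exact fun j _ hj' => hN j hj'
    | succ m ih =>
      intro j hj hjm
      obtain ⟨hx, hy⟩ := ih (j + 1) (by omega) (by omega)
      have e₁ := h.eq_X s j
      have e₂ := h.eq_Y s j
      have z₁ : ∑ᶠ i : ℕ, X (s - 1 - i) j = 0 := finsum_eq_zero_of_forall_eq_zero fun i =>
        (hX j hj i).1
      have z₂ : ∑ᶠ i : ℕ, Y (s - 1 - i) j = 0 := finsum_eq_zero_of_forall_eq_zero fun i =>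
        (hX j hj i).2
      rw [hx, z₁] at e₁
      rw [hy, z₁, z₂] at e₂
      have hxy : X s j = Y s j := mul_left_cancel₀ hs (by linear_combination e₁ - e₂)
      have hx0 : X s j = 0 :=
        (mul_eq_zero.mp (by linear_combination e₁ + c * hxy : (s + a) * X s j = 0)).resolve_left hs
      exact ⟨hx0, hxy ▸ hx0⟩
  exact key N j hj (by omega)

/-- Only the exponents in `-a + ℕ` occur: by lower truncation the smallest exponent in a coset of
`ℤ` has to be `-a`. -/
theorem eq_zero_of_exponent (h : IsFormalSolution a c X Y) {s : ℂ}
    (hs : ∀ m : ℕ, s ≠ -a + m) (j : ℕ) : X s j = 0 ∧ Y s j = 0 := by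
  obtain ⟨N, hN⟩ := eventually_atTop.mp (h.truncation s)
  have key : ∀ m i : ℕ, N ≤ i + m → ∀ j, X (s - i) j = 0 ∧ Y (s - i) j = 0 := by
    intro m
    induction m with
    | zero => exact fun i hi => hN i hi
    | succ m ih =>
      intro i hi j
      refine h.eq_zero_of_lower (fun h0 => hs i (by linear_combination h0)) 0 (fun j _ l => ?_) j
        (Nat.zero_le _)
      have e : s - i - 1 - l = s - ((i + 1 + l : ℕ) : ℂ) := by push_cast; ring
      rw [e]
      exact ih _ (by omega) j
  simpa using key N 0 (by omega) j

theorem neg_exponent_ne {m i : ℕ} (hi : m ≤ i) (l : ℕ) : -a + m - 1 - i ≠ -a + (l : ℂ) := by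
  intro h0
  have : ((m : ℤ) - 1 - i : ℤ) = l := by
    have h1 : (((m : ℤ) - 1 - i : ℤ) : ℂ) = ((l : ℤ) : ℂ) := by push_cast; linear_combination h0
    exact_mod_cast h1
  omega

/-- At most the first power of the logarithm occurs. -/
theorem eq_zero_of_two_le (h : IsFormalSolution a c X Y) (m : ℕ) :
    ∀ j, 2 ≤ j → X (-a + m) j = 0 ∧ Y (-a + m) j = 0 := by
  induction m using Nat.strong_induction_on with
  | _ m ih =>
    have hlow : ∀ j, 2 ≤ j ∨ m = 0 → ∀ i : ℕ,
        X (-a + m - 1 - i) j = 0 ∧ Y (-a + m - 1 - i) j = 0 := by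
      intro j hj i
      rcases lt_or_ge i m with hi | hi
      · have e : -a + m - 1 - i = -a + ((m - 1 - i : ℕ) : ℂ) := by
          rw [Nat.cast_sub (by omega), Nat.cast_sub (by omega)]
          push_cast
          ring
        rw [e]
        exact ih _ (by omega) j (hj.resolve_right (by omega))
      · exact h.eq_zero_of_exponent (neg_exponent_ne hi) j
    rcases Nat.eq_zero_or_pos m with rfl | hm
    · -- at the exponent `-a` the residue matrix is nilpotent of order two
      have e₁ : ∀ j : ℕ, (j + 1) * X (-a) (j + 1) = c * (X (-a) j - Y (-a) j) := fun j => by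
        have := h.eq_X (-a) j
        rw [finsum_eq_zero_of_forall_eq_zero fun i => by simpa using (hlow j (Or.inr rfl) i).1]
          at this
        linear_combination this
      have e₂ : ∀ j : ℕ, (j + 1) * Y (-a) (j + 1) = c * (X (-a) j - Y (-a) j) := fun j => by
        have := h.eq_Y (-a) j
        rw [finsum_eq_zero_of_forall_eq_zero fun i => by simpa using (hlow j (Or.inr rfl) i).2,
          finsum_eq_zero_of_forall_eq_zero fun i => by simpa using (hlow j (Or.inr rfl) i).1]
          at this
        linear_combination this
      intro j hj
      obtain ⟨l, rfl⟩ : ∃ l, j = l + 1 + 1 := ⟨j - 2, by omega⟩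
      have hl : X (-a) (l + 1) = Y (-a) (l + 1) :=
        mul_left_cancel₀ (Nat.cast_add_one_ne_zero l) ((e₁ l).trans (e₂ l).symm)
      have f₁ := e₁ (l + 1)
      have f₂ := e₂ (l + 1)
      rw [hl, sub_self, mul_zero] at f₁ f₂
      have hne := Nat.cast_add_one_ne_zero (R := ℂ) (l + 1)
      rw [Nat.cast_zero, add_zero]
      exact ⟨(mul_eq_zero.mp f₁).resolve_left hne, (mul_eq_zero.mp f₂).resolve_left hne⟩
    · refine h.eq_zero_of_lower ?_ 2 fun j hj i => hlow j (Or.inl hj) i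
      rw [neg_add_eq_sub, sub_add_cancel]
      exact_mod_cast hm.ne'

theorem finsum_lower {Z : ℂ → ℕ → ℂ} {j : ℕ}
    (hZ : ∀ s, (∀ m : ℕ, s ≠ -a + m) → Z s j = 0) (m : ℕ) :
    ∑ᶠ i : ℕ, Z (-a + m - 1 - i) j = ∑ i ∈ Finset.range m, Z (-a + i) j := by
  rw [finsum_eq_sum_of_support_subset (s := Finset.range m), ← Finset.sum_range_reflect]
  · refine Finset.sum_congr rfl fun i hi => ?_
    have hi' := Finset.mem_range.mp hi
    rw [Nat.cast_sub (by omega), Nat.cast_sub (by omega)]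
    congr 1
    push_cast
    ring
  · intro i hi
    by_contra h0
    exact hi (hZ _ (neg_exponent_ne (by simpa using h0)))

theorem rec_X (h : IsFormalSolution a c X Y) (m j : ℕ) :
    m * X (-a + m) j + (j + 1) * X (-a + m) (j + 1) =
      c * (X (-a + m) j - Y (-a + m) j) + a * ∑ i ∈ Finset.range m, X (-a + i) j := by
  have := h.eq_X (-a + m) j
  rw [finsum_lower fun s hs => (h.eq_zero_of_exponent hs j).1] at this
  linear_combination this

theorem rec_Y (h : IsFormalSolution a c X Y) (m j : ℕ) :
    m * Y (-a + m) j + (j + 1) * Y (-a + m) (j + 1) =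
      c * (X (-a + m) j - Y (-a + m) j) + a * ∑ i ∈ Finset.range m, Y (-a + i) j
        + c * ∑ i ∈ Finset.range m, X (-a + i) j := by
  have := h.eq_Y (-a + m) j
  rw [finsum_lower fun s hs => (h.eq_zero_of_exponent hs j).1,
    finsum_lower fun s hs => (h.eq_zero_of_exponent hs j).2] at this
  linear_combination this

end IsFormalSolution

section Correlators

variable {k : ℂ} {W₀ W₁ W₂ W₃ W : Type*}
  [AddCommGroup W₀] [Module ℂ W₀] [AddCommGroup W₁] [Module ℂ W₁] [AddCommGroup W₂] [Module ℂ W₂]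
  [AddCommGroup W₃] [Module ℂ W₃] [AddCommGroup W] [Module ℂ W]
  {M₀ : AffineModule k W₀} {M₁ : AffineModule k W₁} {M₂ : AffineModule k W₂}
  {M₃ : AffineModule k W₃} {M : AffineModule k W}
  (Y₁ : EvenIntertwiningOperator M₁ M M₀) (Y₂ : EvenIntertwiningOperator M₂ M₃ M)
  {v₀ : Module.Dual ℂ W₀} {n e : ℂ} {v₁ w₁ : W₁} {v₂ w₂ : W₂} {v₃ w₃ : W₃}

/-- At `z₁ = 1` and in total degree `-2Δ` the correlation functions solve the formal system; the
exponent `s` of `z₂` corresponds to `p₂ = -s - 1`. -/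
theorem isFormalSolution_corr (hk : k ≠ 0) (h₁ : IsTopPair M₁ 0 n e v₁ w₁)
    (h₂ : IsTopPair M₂ 1 (-n) (-e) v₂ w₂) (h₃ : IsTopPair M₃ 0 n e v₃ w₃)
    (hv₀ : ∀ r : ℤ, r < 0 → ∀ a x, v₀ (M₀.mode r a x) = 0)
    (hψ : ∀ x, v₀ (M₀.mode 0 psiMinus (M₀.mode 0 elN x)) =
      (n + 1 / 2) * v₀ (M₀.mode 0 psiMinus x)) :
    IsFormalSolution (2 * Delta k n e) (e / k)
      (fun s j => corr Y₁ Y₂ v₀ v₁ v₂ w₃ 0 j (2 * Delta k n e - 1 + s) (-s - 1))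
      (fun s j => corr Y₁ Y₂ v₀ v₁ w₂ v₃ 0 j (2 * Delta k n e - 1 + s) (-s - 1)) := by
  have hsum : ∀ (u₂ : W₂) (u₃ : W₃) (s : ℂ) (j : ℕ),
      geomSum (corr Y₁ Y₂ v₀ v₁ u₂ u₃ 0 j) (2 * Delta k n e - 1 + s) (-s) = ∑ᶠ i : ℕ,
        corr Y₁ Y₂ v₀ v₁ u₂ u₃ 0 j (2 * Delta k n e - 1 + (s - 1 - i)) (-(s - 1 - i) - 1) := by
    intro u₂ u₃ s j
    refine finsum_congr fun i => ?_
    congr 1 <;> ring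
  have htr : ∀ (u₂ : W₂) (u₃ : W₃) (s : ℂ), ∀ᶠ i : ℕ in atTop, ∀ j,
      corr Y₁ Y₂ v₀ v₁ u₂ u₃ 0 j (2 * Delta k n e - 1 + (s - i)) (-(s - i) - 1) = 0 := by
    intro u₂ u₃ s
    refine (Y₂.lower_truncation u₂ u₃ (-s - 1)).mono fun i hi j => ?_
    have e : -(s - i) - 1 = -s - 1 + (i : ℂ) := by ring
    rw [e, corr, hi j, map_zero, map_zero]
  have hlog : ∀ (u₂ : W₂) (u₃ : W₃) (p₁ p₂ : ℂ), ∀ᶠ j : ℕ in atTop,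
      corr Y₁ Y₂ v₀ v₁ u₂ u₃ 0 j p₁ p₂ = 0 := by
    intro u₂ u₃ p₁ p₂
    refine (Y₂.log_finite u₂ u₃ p₂).mono fun j hj => ?_
    rw [corr, hj, map_zero, map_zero]
  constructor
  · intro s j
    have h := corr_kz_right_x Y₁ Y₂ hk h₁ h₂ h₃ hv₀ 0 j (2 * Delta k n e - 1 + s) (-s)
    rw [hsum, neg_neg] at h
    exact h
  · intro s j
    have h := corr_kz_right_y Y₁ Y₂ hk h₁ h₂ h₃ hv₀ 0 j (2 * Delta k n e - 1 + s) (-s)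
    have ht : geomSum (corr Y₁ Y₂ v₀ w₁ v₂ v₃ 0 j) (2 * Delta k n e - 1 + s) (-s) =
        geomSum (corr Y₁ Y₂ v₀ v₁ v₂ w₃ 0 j) (2 * Delta k n e - 1 + s) (-s)
          - geomSum (corr Y₁ Y₂ v₀ v₁ w₂ v₃ 0 j) (2 * Delta k n e - 1 + s) (-s) := by
      simp only [geomSum]
      rw [← finsum_sub_distrib (finite_support_corr Y₁ Y₂ v₀ _ _ _ _ _ _ _)
        (finite_support_corr Y₁ Y₂ v₀ _ _ _ _ _ _ _)]
      exact finsum_congr fun i => corr_ward Y₁ Y₂ h₁ h₂ h₃ hψ _ _ _ _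
    rw [ht, hsum, hsum, neg_neg] at h
    linear_combination h
  · intro s
    filter_upwards [htr v₂ w₃ s, htr w₂ v₃ s] with i hx hy j
    exact ⟨hx j, hy j⟩
  · intro s
    exact (hlog v₂ w₃ _ _).and (hlog w₂ v₃ _ _)

end Correlators

/-! ### Power series on the unit disc -/

/-- The coefficients `p m` grow more slowly than every `ρ ^ m` with `ρ > 1`, so that the power
series converges on the unit disc. -/
def SubexponentialGrowth (p : ℕ → ℂ) : Prop :=
  ∀ ρ : ℝ, 1 < ρ → ∃ C : ℝ, ∀ m, ‖p m‖ ≤ C * ρ ^ m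

/-- The sum of a power series. -/
noncomputable def powerSum (p : ℕ → ℂ) (z : ℂ) : ℂ := ∑' m, p m * z ^ m

theorem sum_range_pow_le {ρ : ℝ} (hρ : 1 < ρ) (m : ℕ) :
    ∑ i ∈ Finset.range m, ρ ^ i ≤ ρ ^ m / (ρ - 1) := by
  rw [geom_sum_eq hρ.ne']
  have : 0 < ρ - 1 := by linarith
  gcongr
  linarith

/-- A recursive inequality with `m` on the left-hand side forces subexponential growth. -/
theorem exists_bound_of_recursion {b : ℕ → ℝ} (hb : ∀ m, 0 ≤ b m) {κ K : ℝ} (hK : 0 ≤ K)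
    (h : ∀ m : ℕ, m * b m ≤ κ * b m + K * ∑ i ∈ Finset.range m, b i) {ρ : ℝ} (hρ : 1 < ρ) :
    ∃ C : ℝ, ∀ m, b m ≤ C * ρ ^ m := by
  have hρ' : 0 < ρ - 1 := by linarith
  obtain ⟨N, hN⟩ := exists_nat_gt (κ + K / (ρ - 1))
  set C := ∑ i ∈ Finset.range N, b i with hC
  have hC0 : 0 ≤ C := Finset.sum_nonneg fun i _ => hb i
  refine ⟨C, fun m => ?_⟩
  induction m using Nat.strong_induction_on with
  | _ m ih =>
    rcases lt_or_ge m N with hm | hm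
    · calc b m ≤ C := Finset.single_le_sum (fun i _ => hb i) (Finset.mem_range.mpr hm)
        _ ≤ C * ρ ^ m := le_mul_of_one_le_right hC0 (one_le_pow₀ hρ.le)
    · have hm' : κ + K / (ρ - 1) < m := hN.trans_le (by exact_mod_cast hm)
      have h1 : ∑ i ∈ Finset.range m, b i ≤ C * (ρ ^ m / (ρ - 1)) := by
        calc ∑ i ∈ Finset.range m, b i ≤ ∑ i ∈ Finset.range m, C * ρ ^ i :=
              Finset.sum_le_sum fun i hi => ih i (Finset.mem_range.mp hi)
          _ = C * ∑ i ∈ Finset.range m, ρ ^ i := by rw [Finset.mul_sum]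
          _ ≤ _ := mul_le_mul_of_nonneg_left (sum_range_pow_le hρ m) hC0
      have h2 : (m - κ) * b m ≤ K / (ρ - 1) * (C * ρ ^ m) := by
        calc (m - κ) * b m ≤ K * ∑ i ∈ Finset.range m, b i := by linarith [h m]
          _ ≤ K * (C * (ρ ^ m / (ρ - 1))) := mul_le_mul_of_nonneg_left h1 hK
          _ = _ := by ring
      have hpos : 0 ≤ C * ρ ^ m := by positivity
      have hKρ : 0 ≤ K / (ρ - 1) := by positivity
      have hmκ : 0 < m - κ := by linarith
      refine le_of_mul_le_mul_left (h2.trans ?_) hmκ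
      exact mul_le_mul_of_nonneg_right (by linarith) hpos

namespace SubexponentialGrowth

variable {p q : ℕ → ℂ} {z : ℂ}

theorem sum_range (hp : SubexponentialGrowth p) :
    SubexponentialGrowth fun m => ∑ i ∈ Finset.range m, p i := by
  intro ρ hρ
  obtain ⟨C, hC⟩ := hp ρ hρ
  have hC0 : 0 ≤ C := by simpa using (norm_nonneg _).trans (hC 0)
  refine ⟨C / (ρ - 1), fun m => ?_⟩
  calc ‖∑ i ∈ Finset.range m, p i‖ ≤ ∑ i ∈ Finset.range m, C * ρ ^ i :=
        norm_sum_le_of_le _ fun i _ => hC i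
    _ = C * ∑ i ∈ Finset.range m, ρ ^ i := by rw [Finset.mul_sum]
    _ ≤ C * (ρ ^ m / (ρ - 1)) := mul_le_mul_of_nonneg_left (sum_range_pow_le hρ m) hC0
    _ = _ := by ring

theorem summable_norm (hp : SubexponentialGrowth p) {r : ℝ} (hr0 : 0 ≤ r) (hr : r < 1) :
    Summable fun m => ‖p m‖ * r ^ m := by
  obtain ⟨C, hC⟩ := hp (2 / (1 + r)) (by rw [lt_div_iff₀ (by linarith)]; linarith)
  have hlt : 2 / (1 + r) * r < 1 := by
    rw [div_mul_eq_mul_div, div_lt_one (by linarith)]; linarith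
  refine Summable.of_nonneg_of_le (fun m => by positivity) (fun m => ?_)
    ((summable_geometric_of_lt_one (by positivity) hlt).mul_left C)
  rw [mul_pow, ← mul_assoc]
  exact mul_le_mul_of_nonneg_right (hC m) (by positivity)

theorem summable (hp : SubexponentialGrowth p) (hz : ‖z‖ < 1) :
    Summable fun m => p m * z ^ m :=
  Summable.of_norm (by simpa using hp.summable_norm (norm_nonneg z) hz)

theorem hasSum (hp : SubexponentialGrowth p) (hz : ‖z‖ < 1) :
    HasSum (fun m => p m * z ^ m) (powerSum p z) := (hp.summable hz).hasSum

theorem hasDerivAt (hp : SubexponentialGrowth p) (hz : ‖z‖ < 1) :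
    ∃ d, HasDerivAt (powerSum p) d z ∧ HasSum (fun m : ℕ => m * p m * z ^ m) (z * d) := by
  obtain ⟨r, hzr, hr⟩ := exists_between hz
  have hr0 : 0 ≤ r := (norm_nonneg z).trans hzr.le
  have hmem : z ∈ Metric.ball (0 : ℂ) r := by simpa using hzr
  have hd : ∀ m : ℕ, DifferentiableOn ℂ (fun w : ℂ => p m * w ^ m) (Metric.ball 0 r) := fun m => by
    fun_prop
  have hle : ∀ (m : ℕ) (w : ℂ), w ∈ Metric.ball (0 : ℂ) r → ‖p m * w ^ m‖ ≤ ‖p m‖ * r ^ m := by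
    intro m w hw
    rw [norm_mul, norm_pow]
    have : ‖w‖ ≤ r := by simpa using (Metric.mem_ball.mp hw).le
    gcongr
  have hs := hp.summable_norm hr0 hr
  have h₁ := Complex.differentiableOn_tsum_of_summable_norm hs hd Metric.isOpen_ball hle
  have h₂ := Complex.hasSum_deriv_of_summable_norm hs hd Metric.isOpen_ball hle hmem
  refine ⟨_, (h₁.differentiableAt (Metric.isOpen_ball.mem_nhds hmem)).hasDerivAt, ?_⟩
  have e : (fun m : ℕ => m * p m * z ^ m) = fun m : ℕ => z * deriv (fun w => p m * w ^ m) z := by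
    funext m
    rw [deriv_const_mul_field, deriv_pow_field]
    rcases m with _ | m
    · simp
    · simp only [Nat.add_sub_cancel, pow_succ]
      ring
  rw [e]
  exact h₂.mul_left z

/-- Summation of the coefficients is multiplication by `z (1 - z)⁻¹`. -/
theorem powerSum_sum_range (hp : SubexponentialGrowth p) (hz : ‖z‖ < 1) :
    powerSum (fun m => ∑ i ∈ Finset.range m, p i) z = z / (1 - z) * powerSum p z := by
  have hz1 : 1 - z ≠ 0 := fun h => by
    rw [← sub_eq_zero.mp h, norm_one] at hz
    exact lt_irrefl _ hz
  have hs := hp.sum_range.summable hz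
  have h : powerSum (fun m => ∑ i ∈ Finset.range m, p i) z =
      z * (powerSum (fun m => ∑ i ∈ Finset.range m, p i) z + powerSum p z) := by
    conv_lhs => rw [powerSum, hs.tsum_eq_zero_add]
    rw [powerSum, powerSum, ← hs.tsum_add (hp.summable hz), ← tsum_mul_left]
    simp only [Finset.range_zero, Finset.sum_empty, zero_mul, zero_add]
    refine tsum_congr fun m => ?_
    rw [Finset.sum_range_succ]
    ring
  rw [div_mul_eq_mul_div, eq_div_iff hz1]
  linear_combination h

end SubexponentialGrowth

namespace IsFormalSolution

variable {a c : ℂ} {X Y : ℂ → ℕ → ℂ}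

theorem subexponentialGrowth (h : IsFormalSolution a c X Y) (j : ℕ) (hj : j < 2) :
    SubexponentialGrowth (fun m => X (-a + m) j) ∧
      SubexponentialGrowth (fun m => Y (-a + m) j) := by
  set b : ℕ → ℝ := fun m => ‖X (-a + m) 0‖ + ‖X (-a + m) 1‖ + ‖Y (-a + m) 0‖ + ‖Y (-a + m) 1‖
    with hb
  have hb0 : ∀ m, 0 ≤ b m := fun m => by positivity
  have hXb : ∀ m j : ℕ, j < 2 → ‖X (-a + m) j‖ ≤ b m := by
    intro m j hj
    interval_cases j <;> simp only [hb] <;>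
      linarith [norm_nonneg (X (-a + m) 0), norm_nonneg (X (-a + m) 1), norm_nonneg (Y (-a + m) 0),
        norm_nonneg (Y (-a + m) 1)]
  have hYb : ∀ m j : ℕ, j < 2 → ‖Y (-a + m) j‖ ≤ b m := by
    intro m j hj
    interval_cases j <;> simp only [hb] <;>
      linarith [norm_nonneg (X (-a + m) 0), norm_nonneg (X (-a + m) 1), norm_nonneg (Y (-a + m) 0),
        norm_nonneg (Y (-a + m) 1)]
  have hnext : ∀ m j : ℕ, j < 2 → ‖((j : ℂ) + 1) * X (-a + m) (j + 1)‖ ≤ b m ∧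
      ‖((j : ℂ) + 1) * Y (-a + m) (j + 1)‖ ≤ b m := by
    intro m j hj
    interval_cases j
    · simpa using ⟨hXb m 1 one_lt_two, hYb m 1 one_lt_two⟩
    · simpa [(h.eq_zero_of_two_le m 2 le_rfl).1, (h.eq_zero_of_two_le m 2 le_rfl).2] using hb0 m
  have hsub : ∀ m j : ℕ, j < 2 → ‖c * (X (-a + m) j - Y (-a + m) j)‖ ≤ ‖c‖ * b m := by
    intro m j hj
    rw [norm_mul]
    refine mul_le_mul_of_nonneg_left ((norm_sub_le _ _).trans ?_) (norm_nonneg c)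
    interval_cases j <;> simp only [hb] <;>
      linarith [norm_nonneg (X (-a + m) 0), norm_nonneg (X (-a + m) 1), norm_nonneg (Y (-a + m) 0),
        norm_nonneg (Y (-a + m) 1)]
  have hXr : ∀ m j : ℕ, j < 2 → m * ‖X (-a + m) j‖ ≤
      (‖c‖ + 1) * b m + (‖a‖ + ‖c‖) * ∑ i ∈ Finset.range m, b i := by
    intro m j hj
    have e : (m : ℂ) * X (-a + m) j = c * (X (-a + m) j - Y (-a + m) j)
        + a * ∑ i ∈ Finset.range m, X (-a + i) j - (j + 1) * X (-a + m) (j + 1) := by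
      linear_combination h.rec_X m j
    have hs : ‖∑ i ∈ Finset.range m, X (-a + i) j‖ ≤ ∑ i ∈ Finset.range m, b i :=
      norm_sum_le_of_le _ fun i _ => hXb i j hj
    have h0 : 0 ≤ ∑ i ∈ Finset.range m, b i := (norm_nonneg _).trans hs
    calc m * ‖X (-a + m) j‖ = ‖(m : ℂ) * X (-a + m) j‖ := by simp
      _ ≤ ‖c * (X (-a + m) j - Y (-a + m) j)‖ + ‖a‖ * ‖∑ i ∈ Finset.range m, X (-a + i) j‖
          + ‖((j : ℂ) + 1) * X (-a + m) (j + 1)‖ := by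
        rw [e, ← norm_mul]
        exact (norm_sub_le _ _).trans (add_le_add_left (norm_add_le _ _) _)
      _ ≤ ‖c‖ * b m + ‖a‖ * ∑ i ∈ Finset.range m, b i + b m :=
        add_le_add (add_le_add (hsub m j hj) (mul_le_mul_of_nonneg_left hs (norm_nonneg a)))
          (hnext m j hj).1
      _ ≤ _ := by nlinarith [norm_nonneg c]
  have hYr : ∀ m j : ℕ, j < 2 → m * ‖Y (-a + m) j‖ ≤
      (‖c‖ + 1) * b m + (‖a‖ + ‖c‖) * ∑ i ∈ Finset.range m, b i := by
    intro m j hj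
    have e : (m : ℂ) * Y (-a + m) j = c * (X (-a + m) j - Y (-a + m) j)
        + a * ∑ i ∈ Finset.range m, Y (-a + i) j + c * ∑ i ∈ Finset.range m, X (-a + i) j
        - (j + 1) * Y (-a + m) (j + 1) := by
      linear_combination h.rec_Y m j
    have hs : ‖∑ i ∈ Finset.range m, X (-a + i) j‖ ≤ ∑ i ∈ Finset.range m, b i :=
      norm_sum_le_of_le _ fun i _ => hXb i j hj
    have hs' : ‖∑ i ∈ Finset.range m, Y (-a + i) j‖ ≤ ∑ i ∈ Finset.range m, b i :=
      norm_sum_le_of_le _ fun i _ => hYb i j hj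
    calc m * ‖Y (-a + m) j‖ = ‖(m : ℂ) * Y (-a + m) j‖ := by simp
      _ ≤ ‖c * (X (-a + m) j - Y (-a + m) j)‖ + ‖a‖ * ‖∑ i ∈ Finset.range m, Y (-a + i) j‖
          + ‖c‖ * ‖∑ i ∈ Finset.range m, X (-a + i) j‖
          + ‖((j : ℂ) + 1) * Y (-a + m) (j + 1)‖ := by
        rw [e, ← norm_mul, ← norm_mul]
        exact (norm_sub_le _ _).trans (add_le_add_left (norm_add₃_le) _)
      _ ≤ ‖c‖ * b m + ‖a‖ * ∑ i ∈ Finset.range m, b i + ‖c‖ * ∑ i ∈ Finset.range m, b i + b m :=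
        add_le_add (add_le_add (add_le_add (hsub m j hj)
          (mul_le_mul_of_nonneg_left hs' (norm_nonneg a)))
          (mul_le_mul_of_nonneg_left hs (norm_nonneg c))) (hnext m j hj).2
      _ = _ := by ring
  have hrec : ∀ m : ℕ, m * b m ≤ 4 * (‖c‖ + 1) * b m
      + 4 * (‖a‖ + ‖c‖) * ∑ i ∈ Finset.range m, b i := by
    intro m
    have e : m * b m = m * ‖X (-a + m) 0‖ + m * ‖X (-a + m) 1‖ + m * ‖Y (-a + m) 0‖
        + m * ‖Y (-a + m) 1‖ := by simp only [hb]; ring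
    rw [e]
    linarith [hXr m 0 two_pos, hXr m 1 one_lt_two, hYr m 0 two_pos, hYr m 1 one_lt_two]
  refine ⟨fun ρ hρ => ?_, fun ρ hρ => ?_⟩
  · obtain ⟨C, hC⟩ := exists_bound_of_recursion hb0 (by positivity) hrec hρ
    exact ⟨C, fun m => (hXb m j hj).trans (hC m)⟩
  · obtain ⟨C, hC⟩ := exists_bound_of_recursion hb0 (by positivity) hrec hρ
    exact ⟨C, fun m => (hYb m j hj).trans (hC m)⟩

end IsFormalSolution

/-! ### The analytic solution -/

theorem isOpen_regionU : IsOpen regionU := Metric.isOpen_ball.inter Complex.isOpen_slitPlane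

theorem norm_lt_one_of_mem_regionU {z : ℂ} (hz : z ∈ regionU) : ‖z‖ < 1 := by
  simpa using hz.1

theorem ne_zero_of_mem_regionU {z : ℂ} (hz : z ∈ regionU) : z ≠ 0 :=
  Complex.slitPlane_ne_zero hz.2

theorem one_sub_mem_slitPlane {z : ℂ} (hz : z ∈ regionU) : 1 - z ∈ Complex.slitPlane := by
  refine Complex.mem_slitPlane_iff.mpr (Or.inl ?_)
  have := (Complex.re_le_norm z).trans_lt (norm_lt_one_of_mem_regionU hz)
  simpa using this

theorem hasDerivAt_one_sub_cpow {z : ℂ} (hz : z ∈ regionU) (a : ℂ) :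
    HasDerivAt (fun w => (1 - w) ^ a) (-(a / (1 - z)) * (1 - z) ^ a) z := by
  have h := ((hasDerivAt_id z).const_sub 1).cpow_const (c := a) (one_sub_mem_slitPlane hz)
  refine h.congr_deriv ?_
  rw [id, Complex.cpow_sub _ _ (Complex.slitPlane_ne_zero (one_sub_mem_slitPlane hz)),
    Complex.cpow_one]
  ring

theorem hasDerivAt_cpow {z : ℂ} (hz : z ∈ regionU) (a : ℂ) :
    HasDerivAt (fun w => w ^ a) (a / z * z ^ a) z := by
  have h := (hasDerivAt_id z).cpow_const (c := a) hz.2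
  refine h.congr_deriv ?_
  rw [id, Complex.cpow_sub _ _ (ne_zero_of_mem_regionU hz), Complex.cpow_one]
  ring

namespace IsFormalSolution

variable {a c : ℂ} {X Y : ℂ → ℕ → ℂ}

theorem growth (h : IsFormalSolution a c X Y) (j : ℕ) :
    SubexponentialGrowth (fun m => X (-a + m) j) ∧
      SubexponentialGrowth (fun m => Y (-a + m) j) := by
  rcases lt_or_ge j 2 with hj | hj
  · exact h.subexponentialGrowth j hj
  · constructor <;> intro ρ _ <;> refine ⟨0, fun m => ?_⟩
    · simp [(h.eq_zero_of_two_le m j hj).1]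
    · simp [(h.eq_zero_of_two_le m j hj).2]

theorem hasDerivAt_powerSum_X (h : IsFormalSolution a c X Y) (j : ℕ) {z : ℂ} (hz : ‖z‖ < 1) :
    ∃ d, HasDerivAt (powerSum fun m => X (-a + m) j) d z ∧
      z * d + (j + 1) * powerSum (fun m => X (-a + m) (j + 1)) z =
        c * (powerSum (fun m => X (-a + m) j) z - powerSum (fun m => Y (-a + m) j) z)
        + a * (z / (1 - z) * powerSum (fun m => X (-a + m) j) z) := by
  obtain ⟨d, hd, hsum⟩ := (h.growth j).1.hasDerivAt hz
  refine ⟨d, hd, ?_⟩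
  rw [← (h.growth j).1.powerSum_sum_range hz]
  refine HasSum.unique (hsum.add (((h.growth (j + 1)).1.hasSum hz).mul_left ((j : ℂ) + 1))) ?_
  have h' := ((((h.growth j).1.hasSum hz).sub ((h.growth j).2.hasSum hz)).mul_left c).add
    (((h.growth j).1.sum_range.hasSum hz).mul_left a)
  refine (congrArg (HasSum · _) (funext fun m => ?_)).mpr h'
  linear_combination z ^ m * h.rec_X m j

theorem hasDerivAt_powerSum_Y (h : IsFormalSolution a c X Y) (j : ℕ) {z : ℂ} (hz : ‖z‖ < 1) :
    ∃ d, HasDerivAt (powerSum fun m => Y (-a + m) j) d z ∧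
      z * d + (j + 1) * powerSum (fun m => Y (-a + m) (j + 1)) z =
        c * (powerSum (fun m => X (-a + m) j) z - powerSum (fun m => Y (-a + m) j) z)
        + a * (z / (1 - z) * powerSum (fun m => Y (-a + m) j) z)
        + c * (z / (1 - z) * powerSum (fun m => X (-a + m) j) z) := by
  obtain ⟨d, hd, hsum⟩ := (h.growth j).2.hasDerivAt hz
  refine ⟨d, hd, ?_⟩
  rw [← (h.growth j).1.powerSum_sum_range hz, ← (h.growth j).2.powerSum_sum_range hz]
  refine HasSum.unique (hsum.add (((h.growth (j + 1)).2.hasSum hz).mul_left ((j : ℂ) + 1))) ?_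
  have h' := (((((h.growth j).1.hasSum hz).sub ((h.growth j).2.hasSum hz)).mul_left c).add
    (((h.growth j).2.sum_range.hasSum hz).mul_left a)).add
    (((h.growth j).1.sum_range.hasSum hz).mul_left c)
  refine (congrArg (HasSum · _) (funext fun m => ?_)).mpr h'
  linear_combination z ^ m * h.rec_Y m j

end IsFormalSolution

/-- The function `∑_m (X_{-a+m,0} + X_{-a+m,1} log z) z^m`, that is, `z^a` times the sum of the
logarithmic series with coefficients `X`. -/
noncomputable def logSum (a : ℂ) (X : ℂ → ℕ → ℂ) (z : ℂ) : ℂ :=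
  powerSum (fun m => X (-a + m) 0) z + powerSum (fun m => X (-a + m) 1) z * Complex.log z

namespace IsFormalSolution

variable {a c : ℂ} {X Y : ℂ → ℕ → ℂ}

theorem powerSum_two (h : IsFormalSolution a c X Y) (z : ℂ) :
    powerSum (fun m => X (-a + m) 2) z = 0 ∧ powerSum (fun m => Y (-a + m) 2) z = 0 := by
  constructor
  · simp [powerSum, fun m => (h.eq_zero_of_two_le m 2 le_rfl).1]
  · simp [powerSum, fun m => (h.eq_zero_of_two_le m 2 le_rfl).2]

theorem hasDerivAt_logSum (h : IsFormalSolution a c X Y) {z : ℂ} (hz : z ∈ regionU) :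
    HasDerivAt (logSum a X)
      (c * (logSum a X z - logSum a Y z) / z + a / (1 - z) * logSum a X z) z ∧
    HasDerivAt (logSum a Y)
      (c * (logSum a X z - logSum a Y z) / z
        + (a * logSum a Y z + c * logSum a X z) / (1 - z)) z := by
  have hz1 := norm_lt_one_of_mem_regionU hz
  have hz0 := ne_zero_of_mem_regionU hz
  have hz2 := Complex.slitPlane_ne_zero (one_sub_mem_slitPlane hz)
  have hlog := Complex.hasDerivAt_log hz.2
  constructor
  · obtain ⟨d₀, hd₀, e₀⟩ := h.hasDerivAt_powerSum_X 0 hz1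
    obtain ⟨d₁, hd₁, e₁⟩ := h.hasDerivAt_powerSum_X 1 hz1
    simp only [Nat.cast_zero, zero_add, one_mul, Nat.cast_one, Nat.reduceAdd,
      (h.powerSum_two z).1, mul_zero, add_zero] at e₀ e₁
    refine (hd₀.add (hd₁.mul hlog)).congr_deriv (mul_left_cancel₀ hz0 ?_)
    simp only [logSum]
    field_simp
    field_simp at e₀ e₁
    linear_combination e₀ + Complex.log z * e₁
  · obtain ⟨d₀, hd₀, e₀⟩ := h.hasDerivAt_powerSum_Y 0 hz1
    obtain ⟨d₁, hd₁, e₁⟩ := h.hasDerivAt_powerSum_Y 1 hz1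
    simp only [Nat.cast_zero, zero_add, one_mul, Nat.cast_one, Nat.reduceAdd,
      (h.powerSum_two z).2, mul_zero, add_zero] at e₀ e₁
    refine (hd₀.add (hd₁.mul hlog)).congr_deriv (mul_left_cancel₀ hz0 ?_)
    simp only [logSum]
    field_simp
    field_simp at e₀ e₁
    linear_combination e₀ + Complex.log z * e₁

/-- With `F = (1 - z)^a X` and `G = (1 - z)^a Y` the system reads `z F' = c (F - G)`,
`z G' = c (F - G) + c z (1 - z)⁻¹ F`, and eliminating `G` gives the hypergeometric equation. -/
theorem hypergeometricEquation (h : IsFormalSolution a c X Y) {z : ℂ} (hz : z ∈ regionU) :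
    HypergeometricEquation c (-c) 1 (fun w => (1 - w) ^ a * logSum a X w) z := by
  set F : ℂ → ℂ := fun w => (1 - w) ^ a * logSum a X w with hF
  set G : ℂ → ℂ := fun w => (1 - w) ^ a * logSum a Y w with hG
  have hF' : ∀ w ∈ regionU, HasDerivAt F (c * (F w - G w) / w) w := fun w hw => by
    refine ((hasDerivAt_one_sub_cpow hw a).mul (h.hasDerivAt_logSum hw).1).congr_deriv ?_
    simp only [hF, hG]
    ring
  have hG' : ∀ w ∈ regionU, HasDerivAt G (c * (F w - G w) / w + c * F w / (1 - w)) w :=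
    fun w hw => by
      refine ((hasDerivAt_one_sub_cpow hw a).mul (h.hasDerivAt_logSum hw).2).congr_deriv ?_
      simp only [hF, hG]
      ring
  have hz0 := ne_zero_of_mem_regionU hz
  have hz2 := Complex.slitPlane_ne_zero (one_sub_mem_slitPlane hz)
  have hev : deriv F =ᶠ[nhds z] fun w => c * (F w - G w) / w := by
    filter_upwards [isOpen_regionU.mem_nhds hz] with w hw using (hF' w hw).deriv
  have h2 := hev.deriv_eq.trans
    ((((hF' z hz).sub (hG' z hz)).const_mul c).div (hasDerivAt_id z) hz0).deriv
  rw [HypergeometricEquation, h2, (hF' z hz).deriv]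
  simp only [id, Pi.sub_apply]
  field_simp
  ring

end IsFormalSolution

/-! ### Elementary properties of the differential equation -/

theorem hypergeometricEquation_congr {a b c : ℂ} {f g : ℂ → ℂ} {z : ℂ} (h : f =ᶠ[nhds z] g) :
    HypergeometricEquation a b c f z ↔ HypergeometricEquation a b c g z := by
  rw [HypergeometricEquation, HypergeometricEquation, h.eq_of_nhds, h.deriv_eq,
    h.deriv.deriv_eq]

/-- The equation for `g` is the hypergeometric equation for `z^{2D} (1 - z)^{2D} g`, divided by the
nonvanishing factor `z^{2D} (1 - z)^{2D}`. -/
theorem mainEquation_iff {D c : ℂ} {g : ℂ → ℂ} (hg : AnalyticOnNhd ℂ g regionU) {z : ℂ}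
    (hz : z ∈ regionU) : MainEquation D c g z ↔ HypergeometricEquation c (-c) 1
      (fun w => w ^ (2 * D) * (1 - w) ^ (2 * D) * g w) z := by
  set μ : ℂ → ℂ := fun w => w ^ (2 * D) * (1 - w) ^ (2 * D) with hμ
  have hμ' : ∀ w ∈ regionU, HasDerivAt μ (2 * D * (1 / w - 1 / (1 - w)) * μ w) w := fun w hw => by
    refine ((hasDerivAt_cpow hw _).mul (hasDerivAt_one_sub_cpow hw _)).congr_deriv ?_
    simp only [hμ]
    ring
  have hg' : ∀ w ∈ regionU, HasDerivAt g (deriv g w) w := fun w hw =>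
    (hg w hw).differentiableAt.hasDerivAt
  have hg'' : HasDerivAt (deriv g) (deriv (deriv g) z) z :=
    (hg z hz).deriv.differentiableAt.hasDerivAt
  have hz0 := ne_zero_of_mem_regionU hz
  have hz2 := Complex.slitPlane_ne_zero (one_sub_mem_slitPlane hz)
  have hf' : ∀ w ∈ regionU, HasDerivAt (fun w => μ w * g w)
      (2 * D * (1 / w - 1 / (1 - w)) * μ w * g w + μ w * deriv g w) w := fun w hw =>
    (hμ' w hw).mul (hg' w hw)
  have hev : deriv (fun w => μ w * g w) =ᶠ[nhds z] fun w =>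
      2 * D * (w⁻¹ - (1 - w)⁻¹) * μ w * g w + μ w * deriv g w := by
    filter_upwards [isOpen_regionU.mem_nhds hz] with w hw
    rw [(hf' w hw).deriv, one_div, one_div]
  have h2 := hev.deriv_eq.trans
    ((((((hasDerivAt_inv hz0).sub (((hasDerivAt_id z).const_sub 1).inv hz2)).const_mul
      (2 * D)).mul (hμ' z hz)).mul (hg' z hz)).add ((hμ' z hz).mul hg'')).deriv
  have hμ0 : μ z ≠ 0 := mul_ne_zero (by simp [Complex.cpow_eq_zero_iff, hz0])
    (by simp [Complex.cpow_eq_zero_iff, hz2])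
  have key : (z * (1 - z) * deriv (deriv fun w => μ w * g w) z
      + (1 - (c + -c + 1) * z) * deriv (fun w => μ w * g w) z - c * -c * (μ z * g z)) =
      μ z * (z * (1 - z) * deriv (deriv g) z + ((4 * D + 1) - (8 * D + 1) * z) * deriv g z
        + 4 * D ^ 2 * z⁻¹ * g z + 2 * D * (2 * D - 1) * (1 - z)⁻¹ * g z
        + (c ^ 2 - 16 * D ^ 2) * g z) := by
    rw [h2, (hf' z hz).deriv]
    simp only [id, Pi.sub_apply, Pi.mul_apply, Pi.inv_apply]
    field_simp
    ring
  rw [MainEquation, HypergeometricEquation, key, mul_eq_zero, or_iff_right hμ0]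

/-- Coefficients `A / (z (1 - z))` and `B / (z (1 - z))²` with polynomials `A`, `B` of degree
at most one and two are those of a Fuchsian equation with singular points among `0`, `1`, `∞`. -/
theorem isFuchsian_mainEquation (D c : ℂ) : IsFuchsianZeroOneInfty
    (fun z => ((4 * D + 1) - (8 * D + 1) * z) / (z * (1 - z)))
    (fun z => (4 * D ^ 2 * z⁻¹ + 2 * D * (2 * D - 1) * (1 - z)⁻¹ + (c ^ 2 - 16 * D ^ 2)) /
      (z * (1 - z))) := by
  refine ⟨fun a h0 h1 => ?_, ?_, ?_, ?_⟩
  · have h1' : 1 - a ≠ 0 := sub_ne_zero.mpr (Ne.symm h1)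
    have h2 : a * (1 - a) ≠ 0 := mul_ne_zero h0 h1'
    constructor <;> fun_prop (disch := assumption)
  · refine ⟨fun z => ((4 * D + 1) - (8 * D + 1) * z) / (1 - z),
      fun z => (4 * D ^ 2 + 2 * D * (2 * D - 1) * z * (1 - z)⁻¹ + (c ^ 2 - 16 * D ^ 2) * z) /
        (1 - z), ?_, ?_, ?_⟩
    · have : (1 : ℂ) - 0 ≠ 0 := by simp
      fun_prop (disch := assumption)
    · have : (1 : ℂ) - 0 ≠ 0 := by simp
      fun_prop (disch := assumption)
    · filter_upwards [self_mem_nhdsWithin, mem_nhdsWithin_of_mem_nhds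
        (isOpen_ne.mem_nhds (show (0 : ℂ) ≠ 1 from zero_ne_one))] with z hz hz1
      have hz0 : z ≠ 0 := hz
      have hz2 : 1 - z ≠ 0 := sub_ne_zero.mpr (Ne.symm hz1)
      constructor <;> field_simp <;> ring
  · refine ⟨fun z => -((4 * D + 1) - (8 * D + 1) * z) / z,
      fun z => (4 * D ^ 2 * z⁻¹ * (1 - z) + 2 * D * (2 * D - 1)
        + (c ^ 2 - 16 * D ^ 2) * (1 - z)) / z, ?_, ?_, ?_⟩
    · have : (1 : ℂ) ≠ 0 := one_ne_zero
      fun_prop (disch := assumption)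
    · have : (1 : ℂ) ≠ 0 := one_ne_zero
      fun_prop (disch := assumption)
    · filter_upwards [self_mem_nhdsWithin, mem_nhdsWithin_of_mem_nhds
        (isOpen_ne.mem_nhds (show (1 : ℂ) ≠ 0 from one_ne_zero))] with z hz hz0
      have hz1 : z ≠ 1 := hz
      have hz2 : 1 - z ≠ 0 := sub_ne_zero.mpr (Ne.symm hz1)
      have hz0' : z ≠ 0 := hz0
      constructor <;> field_simp <;> ring
  · refine ⟨fun w => 2 - ((4 * D + 1) * w - (8 * D + 1)) / (w - 1),
      fun w => (4 * D ^ 2 * w + 2 * D * (2 * D - 1) * w / (w - 1) + (c ^ 2 - 16 * D ^ 2)) /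
        (w - 1), ?_, ?_, ?_⟩
    · have : (0 : ℂ) - 1 ≠ 0 := by simp
      fun_prop (disch := assumption)
    · have : (0 : ℂ) - 1 ≠ 0 := by simp
      fun_prop (disch := assumption)
    · filter_upwards [self_mem_nhdsWithin, mem_nhdsWithin_of_mem_nhds
        (isOpen_ne.mem_nhds (show (0 : ℂ) ≠ 1 from zero_ne_one))] with w hw hw1
      have hw0 : w ≠ 0 := hw
      have hw2 : w - 1 ≠ 0 := sub_ne_zero.mpr hw1
      have e : 1 - w⁻¹ = (w - 1) / w := by field_simp
      rw [e]
      constructor <;> field_simp <;> ring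

/-! ### Summation of the correlation function -/

section Correlators

variable {k : ℂ} {W₀ W₁ W₂ W₃ W : Type*}
  [AddCommGroup W₀] [Module ℂ W₀] [AddCommGroup W₁] [Module ℂ W₁] [AddCommGroup W₂] [Module ℂ W₂]
  [AddCommGroup W₃] [Module ℂ W₃] [AddCommGroup W] [Module ℂ W]
  {M₀ : AffineModule k W₀} {M₁ : AffineModule k W₁} {M₂ : AffineModule k W₂}
  {M₃ : AffineModule k W₃} {M : AffineModule k W}
  (Y₁ : EvenIntertwiningOperator M₁ M M₀) (Y₂ : EvenIntertwiningOperator M₂ M₃ M)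
  {v₀ : Module.Dual ℂ W₀} {n e : ℂ} {v₁ w₁ : W₁} {v₂ w₂ : W₂} {v₃ w₃ : W₃}

/-- Among the terms of `⟨v₀, 𝒴₁(v₁, 1) 𝒴₂(v₂, z) w₃⟩` only those with exponents in `-2Δ + ℕ` and at
most the first power of `log z` survive. -/
theorem hasSum_productTerm (hk : k ≠ 0) (h₁ : IsTopPair M₁ 0 n e v₁ w₁)
    (h₂ : IsTopPair M₂ 1 (-n) (-e) v₂ w₂) (h₃ : IsTopPair M₃ 0 n e v₃ w₃)
    (hv₀ : ∀ r : ℤ, r < 0 → ∀ a x, v₀ (M₀.mode r a x) = 0)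
    (hψ : ∀ x, v₀ (M₀.mode 0 psiMinus (M₀.mode 0 elN x)) =
      (n + 1 / 2) * v₀ (M₀.mode 0 psiMinus x)) {z : ℂ} (hz : z ∈ regionU) :
    HasSum (productTerm Y₁ Y₂ v₀ v₁ v₂ w₃ 1 z)
      (z ^ (-(2 * Delta k n e)) * logSum (2 * Delta k n e)
        (fun s j => corr Y₁ Y₂ v₀ v₁ v₂ w₃ 0 j (2 * Delta k n e - 1 + s) (-s - 1)) z) := by
  have h := isFormalSolution_corr Y₁ Y₂ hk h₁ h₂ h₃ hv₀ hψ
  set a := 2 * Delta k n e with ha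
  set X : ℂ → ℕ → ℂ := fun s j => corr Y₁ Y₂ v₀ v₁ v₂ w₃ 0 j (a - 1 + s) (-s - 1) with hX
  have hz0 := ne_zero_of_mem_regionU hz
  have hz1 := norm_lt_one_of_mem_regionU hz
  -- the exponents of the surviving terms, without and with a logarithm
  let ι : ℕ ⊕ ℕ → (ℂ × ℕ) × (ℂ × ℕ) := Sum.elim
    (fun m => ((a - 1 + (-a + m), 0), (-(-a + m) - 1, 0)))
    (fun m => ((a - 1 + (-a + m), 0), (-(-a + m) - 1, 1)))
  have hι : Function.Injective ι := by
    rintro (m | m) (m' | m') hmm <;> simp [ι] at hmm ⊢ <;> exact hmm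
  have hzero : ∀ q, q ∉ Set.range ι → productTerm Y₁ Y₂ v₀ v₁ v₂ w₃ 1 z q = 0 := by
    rintro ⟨⟨p₁, j₁⟩, ⟨p₂, j₂⟩⟩ hq
    rcases Nat.eq_zero_or_pos j₁ with rfl | hj₁
    · have hcorr : corr Y₁ Y₂ v₀ v₁ v₂ w₃ 0 j₂ p₁ p₂ = 0 := by
        by_cases hp : p₁ + p₂ + 2 = 2 * Delta k n e
        · have e₁ : p₁ = a - 1 + (-p₂ - 1) := by rw [ha]; linear_combination hp
          have e₂ : p₂ = -(-p₂ - 1) - 1 := by ring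
          have e : corr Y₁ Y₂ v₀ v₁ v₂ w₃ 0 j₂ p₁ p₂ = X (-p₂ - 1) j₂ := by
            simp only [hX]
            rw [← e₁, ← e₂]
          rw [e]
          by_cases hm : ∃ m : ℕ, -p₂ - 1 = -a + m
          · obtain ⟨m, hm⟩ := hm
            have e₃ : p₂ = -(-a + m) - 1 := by linear_combination -hm
            rw [hm] at e₁ ⊢
            rcases lt_or_ge j₂ 2 with hj | hj
            · refine absurd ?_ hq
              interval_cases j₂
              · exact ⟨Sum.inl m, by simp only [ι, Sum.elim_inl, ← e₁, ← e₃]⟩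
              · exact ⟨Sum.inr m, by simp only [ι, Sum.elim_inr, ← e₁, ← e₃]⟩
            · exact (h.eq_zero_of_two_le m j₂ hj).1
          · exact (h.eq_zero_of_exponent (fun m hm' => hm ⟨m, hm'⟩) j₂).1
        · exact (corr_eq_zero_of_degree Y₁ Y₂ hk h₁ h₂ h₃ hv₀ hψ 0 j₂ hp).1
      rw [corr] at hcorr
      simp only [productTerm, hcorr, zero_mul]
    · simp [productTerm, hj₁.ne']
  have hpow : ∀ m : ℕ, z ^ (-(-(-a + m) - 1) - 1) = z ^ (-a) * z ^ m := fun m => by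
    rw [show -(-(-a + (m : ℂ)) - 1) - 1 = -a + m by ring, Complex.cpow_add _ _ hz0,
      Complex.cpow_natCast]
  rw [← hι.hasSum_iff hzero, logSum, mul_add]
  refine HasSum.sum ?_ ?_
  · refine (congrArg (HasSum · _) (funext fun m => ?_)).mpr
      (((h.growth 0).1.hasSum hz1).mul_left (z ^ (-a)))
    simp only [Function.comp_apply, ι, Sum.elim_inl, productTerm, hpow, Complex.one_cpow, pow_zero,
      mul_one, hX, corr]
    ring
  · refine (congrArg (HasSum · _) (funext fun m => ?_)).mpr
      ((((h.growth 1).1.hasSum hz1).mul_right (Complex.log z)).mul_left (z ^ (-a)))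
    simp only [Function.comp_apply, ι, Sum.elim_inr, productTerm, hpow, Complex.one_cpow, pow_zero,
      mul_one, pow_one, hX, corr]
    ring

end Correlators

end GL11

/-- `V` is the generalized Verma module with parameters `(n, e)`, and `V'` its contragredient, with
the parity-reversed generalized Verma module with parameters `(-n, -e)` as a model of `V'` for the
vector `v₂ = v_{-n,-e}`; `v₀` is any vector of `V'` of the lowest conformal weight `Δ_{n,e}`. -/
theorem mainTheorem9 (k n e : ℂ) (hk : k ≠ 0) (he : ∀ m : ℤ, e / k ≠ m)
    {W : Type*} [AddCommGroup W] [Module ℂ W]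
    (M : GL11.AffineModule k W) (hM : M.IsGradingRestricted)
    (Y₁ : GL11.EvenIntertwiningOperator (GL11.vermaModule k n e) M (GL11.vermaModule k n e))
    (Y₂ : GL11.EvenIntertwiningOperator (GL11.vermaModule k (-n) (-e)).parityReverse
      (GL11.vermaModule k n e) M)
    (v₀ : Module.Dual ℂ (GL11.Verma k n e))
    (hv₀ : v₀ ∈ (GL11.vermaModule k n e).contragredientWeightSpace (GL11.Delta k n e))
    (φ : ℂ → ℂ)
    (hφ : φ = GL11.fourPoint Y₁ Y₂ v₀ (GL11.hwVector k n e) (GL11.hwVector k (-n) (-e))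
      ((GL11.vermaModule k n e).mode 0 GL11.psiMinus (GL11.hwVector k n e))) :
    -- the series converges absolutely on `U`, to an analytic function
    (∀ z ∈ GL11.regionU, Summable (GL11.productTerm Y₁ Y₂ v₀ (GL11.hwVector k n e)
      (GL11.hwVector k (-n) (-e))
      ((GL11.vermaModule k n e).mode 0 GL11.psiMinus (GL11.hwVector k n e)) 1 z)) ∧
    AnalyticOnNhd ℂ φ GL11.regionU ∧
    -- the differential equation for `φ`
    (∀ z ∈ GL11.regionU, GL11.MainEquation (GL11.Delta k n e) (e / k) φ z) ∧
    -- the differential equation is Fuchsian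
    GL11.IsFuchsianZeroOneInfty
      (fun z => ((4 * GL11.Delta k n e + 1) - (8 * GL11.Delta k n e + 1) * z) / (z * (1 - z)))
      (fun z => (4 * GL11.Delta k n e ^ 2 * z⁻¹
        + 2 * GL11.Delta k n e * (2 * GL11.Delta k n e - 1) * (1 - z)⁻¹
        + ((e / k) ^ 2 - 16 * GL11.Delta k n e ^ 2)) / (z * (1 - z))) ∧
    -- multiplication by `z ^ (2Δ) (1 - z) ^ (2Δ)` turns it into the hypergeometric equation
    (∀ g : ℂ → ℂ, AnalyticOnNhd ℂ g GL11.regionU →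
      ∀ z ∈ GL11.regionU, (GL11.MainEquation (GL11.Delta k n e) (e / k) g z ↔
        GL11.HypergeometricEquation (e / k) (-(e / k)) 1
          (fun w => w ^ (2 * GL11.Delta k n e) * (1 - w) ^ (2 * GL11.Delta k n e) * g w) z)) ∧
    (∀ z ∈ GL11.regionU, GL11.HypergeometricEquation (e / k) (-(e / k)) 1
      (fun w => w ^ (2 * GL11.Delta k n e) * (1 - w) ^ (2 * GL11.Delta k n e) * φ w) z) := by
  have hv := fun (r : ℤ) (hr : r < 0) a x => GL11.contragredient_apply_mode_neg hk hv₀ hr a x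
  have hψ := GL11.contragredient_apply_psiMinus hk hv₀
  have h₁ := GL11.isTopPair_verma k n e
  have h₂ := GL11.isTopPair_verma_parityReverse k (-n) (-e)
  have hsum := fun z (hz : z ∈ GL11.regionU) =>
    GL11.hasSum_productTerm Y₁ Y₂ hk h₁ h₂ h₁ hv hψ hz
  have hsol := GL11.isFormalSolution_corr Y₁ Y₂ hk h₁ h₂ h₁ hv hψ
  have hφU : ∀ z ∈ GL11.regionU, φ z = z ^ (-(2 * GL11.Delta k n e)) *
      GL11.logSum (2 * GL11.Delta k n e) _ z := fun z hz => by
    rw [hφ]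
    exact (hsum z hz).tsum_eq
  have hφan : AnalyticOnNhd ℂ φ GL11.regionU := by
    refine DifferentiableOn.analyticOnNhd (fun z hz => ?_) GL11.isOpen_regionU
    refine DifferentiableWithinAt.congr ?_ hφU (hφU z hz)
    exact ((GL11.hasDerivAt_cpow hz _).mul
      (hsol.hasDerivAt_logSum hz).1).differentiableAt.differentiableWithinAt
  have hhyp : ∀ z ∈ GL11.regionU, GL11.HypergeometricEquation (e / k) (-(e / k)) 1
      (fun w => w ^ (2 * GL11.Delta k n e) * (1 - w) ^ (2 * GL11.Delta k n e) * φ w) z := by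
    intro z hz
    refine (GL11.hypergeometricEquation_congr ?_).mpr (hsol.hypergeometricEquation hz)
    filter_upwards [GL11.isOpen_regionU.mem_nhds hz] with w hw
    have hw0 := GL11.ne_zero_of_mem_regionU hw
    have hpow : w ^ (2 * GL11.Delta k n e) * w ^ (-(2 * GL11.Delta k n e)) = 1 := by
      rw [← Complex.cpow_add _ _ hw0, add_neg_cancel, Complex.cpow_zero]
    rw [hφU w hw]
    linear_combination (1 - w) ^ (2 * GL11.Delta k n e) *
      GL11.logSum (2 * GL11.Delta k n e) _ w * hpow
  exact ⟨fun z hz => (hsum z hz).summable, hφan,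
    fun z hz => (GL11.mainEquation_iff hφan hz).mpr (hhyp z hz),
    GL11.isFuchsian_mainEquation _ _, fun g hg z hz => GL11.mainEquation_iff hg hz, hhyp⟩
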